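/- Let $0\le\nu<1$, let $\alpha\in\mathbb C$ with $\operatorname{Re}\alpha>\frac{1-\nu}{2}$, and let $\lambda\in\mathbb C\setminus\{0\}$. For $p,q>0$, $p\ne q$, put $$G(p,q)=\frac1{\Gamma(2\alpha)}\Bigl(\frac{|p^2-q^2|}{2q}\Bigr)^{2\alpha-1}{}_2F_1\Bigl(\alpha+\tfrac{\nu-1}2,\alpha;2\alpha;1-\tfrac{p^2}{q^2}\Bigr),$$ where ${}_2F_1$ is the Gauss hypergeometric function (analytically continued to arguments $\le -1$), and $$K(p,q)=\frac{2q}{|p^2-q^2|}\int_0^1 S_{\alpha,\nu}\Bigl(\frac{z(t)}{\lambda}\Bigr)\frac{dt}{t^{\frac{3-\nu}2}(1-t)^{\frac{1+\nu}2}},\qquad z(t)=\left(\frac{t(1-t)(p^2-q^2)^2}{\bigl(1-(1-\frac{p^2}{q^2})t\bigr)4q^2}\right)^{\alpha},$$ $$S_{\alpha,\nu}(z)=\sum_{k=1}^\infty\frac{z^k}{\Gamma(\alpha k+\frac{\nu-1}2)\,\Gamma(\alpha k-\frac{\nu-1}2)}$$ (a series of Wright/Fox type). The series converges for every $z\in\mathbb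 C$, and the integral defining $K(p,q)$ converges absolutely for all $p,q>0$, $p\neq q$. For $\kappa\ge0$ let $X_\kappa$ be the space of measurable functions $f:(0,\infty)\to\mathbb C$ (modulo equality almost everywhere) with $\int_0^b y^{\kappa}|f(y)|\,dy<\infty$ for every $b>0$. (a) The Bessel fractional integration operator $(B_{0+}^{\nu,\alpha}f)(x)=\int_0^x G(y,x)f(y)\,dy$ maps $X_0$ to itself, and its resolvent $R_\lambda=(B_{0+}^{\nu,\alpha}-\lambda I)^{-1}$ on $X_0$ exists and equals $$R_\lambda f(x)=-\frac1\lambda f(x)-\frac1\lambda\int_0^x K(y,x)f(y)\,dy .$$ (b) The operator $(\widetilde B_{0+}^{\nu,\alpha}f)(x)=\int_0^x G(x,y)f(y)\,dy$ maps $X_\nu$ to itself, and its resolvent $\widetilde R_\lambda=(\widetilde B_{0+}^{\nu,\alpha}-\lambda I)^{-1}$ on $X_\nu$ exists and equals $$\widetilde R_\lambda f(x)=-\frac1\lambda f(x)-\frac1\lambda\int_0^x K(x,y)f(y)\,dy .$$ In both cases the integrals converge absolutely for almost every $x>0$. (c) For $\nu=0$ this is the Hille–Tamarkin–Dzhrbashyan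 formula for the Riemann–Liouville integral of order $2\alpha$: for $0<y<x$, $$G(x,y)=G(y,x)=\frac{(x-y)^{2\alpha-1}}{\Gamma(2\alpha)},\qquad K(x,y)=K(y,x)=\frac1\lambda(x-y)^{2\alpha-1}E_{2\alpha,2\alpha}\Bigl(\frac{(x-y)^{2\alpha}}\lambda\Bigr),$$ where $E_{\beta,\gamma}(z)=\sum_{n\ge0}z^n/\Gamma(\beta n+\gamma)$ is the Mittag-Leffler function. -/

import Mathlib

open MeasureTheory Set Filter

noncomputable section

/-- Gauss' hypergeometric function `₂F₁(a, b; c; z)` for real `z < 1`: the hypergeometric series for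
`|z| < 1`, and its analytic continuation to `z ≤ -1`, given by Pfaff's transformation
`₂F₁(a, b; c; z) = (1 - z)^(-a) ₂F₁(a, c - b; c; z / (z - 1))`, where `z / (z - 1) ∈ [1/2, 1)`. -/
def gaussHyp (a b c : ℂ) (z : ℝ) : ℂ :=
  if |z| < 1 then ordinaryHypergeometric a b c (z : ℂ)
  else ((1 - z : ℝ) : ℂ) ^ (-a) * ordinaryHypergeometric a (c - b) c ((z / (z - 1) : ℝ) : ℂ)

/-- The kernel
`G_{ν,α}(p, q) = Γ(2α)⁻¹ (|p² - q²| / (2q))^(2α - 1) ₂F₁(α + (ν - 1)/2, α; 2α; 1 - p²/q²)`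
of Bessel fractional integration, for `p, q > 0`, `p ≠ q`. -/
def besselFracKernel (ν : ℝ) (α : ℂ) (p q : ℝ) : ℂ :=
  (Complex.Gamma (2 * α))⁻¹ * ((|p ^ 2 - q ^ 2| / (2 * q) : ℝ) : ℂ) ^ (2 * α - 1) *
    gaussHyp (α + ((ν : ℂ) - 1) / 2) α (2 * α) (1 - p ^ 2 / q ^ 2)

/-- The left-sided Bessel fractional integral `B_{a+}^{ν,α}`, with kernel
`Γ(2α)⁻¹ ((x² - y²) / (2x))^(2α - 1) ₂F₁(α + (ν - 1)/2, α; 2α; 1 - y²/x²)` on `a < y < x`. -/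
def besselFracIntLeft (ν : ℝ) (α : ℂ) (a : ℝ) (f : ℝ → ℂ) (x : ℝ) : ℂ :=
  ∫ y in Ioo a x, besselFracKernel ν α y x * f y

/-- The Bessel fractional integral over `(a, x)` whose kernel is
`Γ(2α)⁻¹ ((x² - y²) / (2y))^(2α - 1) ₂F₁(α + (ν - 1)/2, α; 2α; 1 - x²/y²)` on `a < y < x`, that is,
the expression that is the kernel of the right-sided operator on `(x, b)`. -/
def besselFracIntLeft' (ν : ℝ) (α : ℂ) (a : ℝ) (f : ℝ → ℂ) (x : ℝ) : ℂ :=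
  ∫ y in Ioo a x, besselFracKernel ν α x y * f y

/-- The `k`-th term (`k ≥ 1`) of the series `S_{α,ν}(z)`. -/
def besselWrightTerm (α : ℂ) (ν : ℝ) (z : ℂ) (k : ℕ) : ℂ :=
  z ^ k / (Complex.Gamma (α * k + ((ν : ℂ) - 1) / 2) * Complex.Gamma (α * k - ((ν : ℂ) - 1) / 2))

/-- `S_{α,ν}(z) = ∑_{k ≥ 1} z^k / (Γ(αk + (ν - 1)/2) Γ(αk - (ν - 1)/2))`. -/
def besselWright (α : ℂ) (ν : ℝ) (z : ℂ) : ℂ :=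
  ∑' k : ℕ, besselWrightTerm α ν z (k + 1)

/-- `z(t) = (t (1 - t) (p² - q²)² / ((1 - (1 - p²/q²) t) 4q²))^α`. -/
def besselResolventArg (α : ℂ) (p q t : ℝ) : ℂ :=
  ((t * (1 - t) * (p ^ 2 - q ^ 2) ^ 2 / ((1 - (1 - p ^ 2 / q ^ 2) * t) * (4 * q ^ 2)) : ℝ) : ℂ) ^ α

/-- The integrand `S_{α,ν}(z(t) / lam) / (t^((3 - ν)/2) (1 - t)^((1 + ν)/2))`. -/
def besselResolventIntegrand (ν : ℝ) (α lam : ℂ) (p q t : ℝ) : ℂ :=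
  besselWright α ν (besselResolventArg α p q t / lam) /
    ((t ^ ((3 - ν) / 2) * (1 - t) ^ ((1 + ν) / 2) : ℝ) : ℂ)

/-- The resolvent kernel
`K(p, q) = (2q / |p² - q²|) ∫₀¹ S_{α,ν}(z(t) / lam) dt / (t^((3 - ν)/2) (1 - t)^((1 + ν)/2))`. -/
def besselResolventKernel (ν : ℝ) (α lam : ℂ) (p q : ℝ) : ℂ :=
  ((2 * q / |p ^ 2 - q ^ 2| : ℝ) : ℂ) *
    ∫ t in Ioo (0 : ℝ) 1, besselResolventIntegrand ν α lam p q t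

/-- `R f (x) = - f(x) / lam - (1 / lam) ∫₀ˣ K(x, y) f(y) dy`. -/
def resolventForm (lam : ℂ) (K : ℝ → ℝ → ℂ) (f : ℝ → ℂ) (x : ℝ) : ℂ :=
  -(1 / lam) * f x - (1 / lam) * ∫ y in Ioo 0 x, K x y * f y

/-- Functions on the half-line `(0, ∞)` for which `y^κ f(y)` is integrable on every `(0, b)`. -/
def locIntegrableSpace (κ : ℝ) : Set (ℝ → ℂ) :=
  {f | ∀ b : ℝ, 0 < b → IntegrableOn (fun y : ℝ => ((y ^ κ : ℝ) : ℂ) * f y) (Ioo 0 b)}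

/-- `R` is the resolvent `(B - lam)⁻¹` of the operator `B` on the space `X` of functions on
`(0, ∞)` (taken up to equality almost everywhere): `B` and `R` map `X` to itself, and `R` is a
right and a left inverse of `B - lam`. -/
def IsResolventAt (X : Set (ℝ → ℂ)) (B : (ℝ → ℂ) → ℝ → ℂ) (lam : ℂ) (R : (ℝ → ℂ) → ℝ → ℂ) : Prop :=
  (∀ f ∈ X, B f ∈ X) ∧ (∀ f ∈ X, R f ∈ X) ∧
  (∀ f ∈ X, (fun x => B (R f) x - lam * R f x) =ᵐ[volume.restrict (Ioi 0)] f) ∧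
  (∀ f ∈ X, R (fun x => B f x - lam * f x) =ᵐ[volume.restrict (Ioi 0)] f)

/-- The integral `∫₀ˣ G(x, y) f(y) dy` converges absolutely for almost every `x > 0`. -/
def ConvergesAE (G : ℝ → ℝ → ℂ) (f : ℝ → ℂ) : Prop :=
  ∀ᵐ x ∂(volume.restrict (Ioi (0 : ℝ))), IntegrableOn (fun y => G x y * f y) (Ioo 0 x)

/-- The Mittag-Leffler function `E_{β,γ}(z) = ∑_{n ≥ 0} z^n / Γ(βn + γ)`. -/
def mittagLeffler (β γ z : ℂ) : ℂ :=
  ∑' n : ℕ, z ^ n / Complex.Gamma (β * n + γ)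

end

/-!
The operator `B` with kernel `G` is a Volterra operator on `L¹(0, b)`, and the integral that defines
`K` is, term by term, the Neumann series `∑ B ^ (n + 1) / lam ^ (n + 1)`. Indeed, by Euler's
integral for `₂F₁` the kernel of order `α (n + 1)` divided by `lam ^ (n + 1)` is the integral of the
`(n + 1)`-st term of the Wright series, and the operators of orders `β` and `γ` compose to the one
of order `β + γ`. The latter holds on powers `x ^ n`, whose images are explicit quotients of Gamma
functions, and polynomials are dense in `L¹(0, b)`. Reciprocal Gamma functions make the series
converge in operator norm.

Both kernels times `p ^ ν` are symmetric in `p` and `q`, so multiplication by `x ^ ν` turns the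
second resolvent into the first. For `ν = 0` the integrals over `t` reduce to beta integrals by the
Cauchy-Schlömilch substitution.
-/

theorem ne_neg_natCast_of_re_pos {s : ℂ} (hs : 0 < s.re) (k : ℕ) : s ≠ -k := by
  rintro rfl
  rw [Complex.neg_re, Complex.natCast_re] at hs
  linarith [k.cast_nonneg (α := ℝ)]

theorem re_add_natCast_pos {s : ℂ} (hs : 0 < s.re) (k : ℕ) : 0 < (s + k).re := by
  rw [Complex.add_re, Complex.natCast_re]
  positivity

theorem ofReal_cpow_eq_exp {x : ℝ} (hx : 0 < x) (s : ℂ) :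
    (x : ℂ) ^ s = Complex.exp (Real.log x * s) := by
  rw [Complex.cpow_def_of_ne_zero (by exact_mod_cast hx.ne'), Complex.ofReal_log hx.le]

theorem ofReal_cpow_add {x : ℝ} (hx : 0 < x) (s t : ℂ) :
    (x : ℂ) ^ (s + t) = (x : ℂ) ^ s * (x : ℂ) ^ t :=
  Complex.cpow_add _ _ (by exact_mod_cast hx.ne')

/-! ### Beta integrals and Gamma quotients -/

theorem integrableOn_beta {a b : ℂ} (ha : 0 < a.re) (hb : 0 < b.re) :
    IntegrableOn (fun t : ℝ => (t : ℂ) ^ (a - 1) * ((1 - t : ℝ) : ℂ) ^ (b - 1)) (Ioo 0 1) := by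
  simp only [Complex.ofReal_sub, Complex.ofReal_one]
  exact (intervalIntegrable_iff_integrableOn_Ioo_of_le zero_le_one).1
    (Complex.betaIntegral_convergent ha hb)

theorem integral_beta {a b : ℂ} (ha : 0 < a.re) (hb : 0 < b.re) :
    ∫ t in Ioo (0 : ℝ) 1, (t : ℂ) ^ (a - 1) * ((1 - t : ℝ) : ℂ) ^ (b - 1) =
      Complex.Gamma a * Complex.Gamma b / Complex.Gamma (a + b) := by
  rw [← Complex.betaIntegral_eq_Gamma_mul_div a b ha hb, Complex.betaIntegral,
    intervalIntegral.integral_of_le zero_le_one, integral_Ioc_eq_integral_Ioo]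
  simp only [Complex.ofReal_sub, Complex.ofReal_one]

theorem tendsto_integral_cpow_mul {α : ℂ} (hα : 0 < α.re) {g : ℝ → ℂ}
    (hg : IntegrableOn g (Ioo 0 1)) :
    Tendsto (fun k : ℕ => ∫ t in Ioo (0 : ℝ) 1, (t : ℂ) ^ (α * k) * g t) atTop (nhds 0) := by
  have hnorm : ∀ t ∈ Ioo (0 : ℝ) 1, ∀ k : ℕ, ‖(t : ℂ) ^ (α * k)‖ = (t ^ α.re) ^ k := by
    intro t ht k
    rw [Complex.norm_cpow_eq_rpow_re_of_pos ht.1, ← Real.rpow_natCast, ← Real.rpow_mul ht.1.le,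
      ← Complex.ofReal_natCast, Complex.re_mul_ofReal]
  have hlim : ∀ t ∈ Ioo (0 : ℝ) 1,
      Tendsto (fun k : ℕ => (t : ℂ) ^ (α * k) * g t) atTop (nhds 0) := by
    intro t ht
    refine squeeze_zero_norm (a := fun k : ℕ => (t ^ α.re) ^ k * ‖g t‖)
      (fun k => by rw [norm_mul, hnorm t ht k]) ?_
    simpa using (tendsto_pow_atTop_nhds_zero_of_lt_one (Real.rpow_nonneg ht.1.le _)
      (Real.rpow_lt_one ht.1.le ht.2 hα)).mul_const ‖g t‖
  rw [← integral_zero ℝ ℂ (μ := volume.restrict (Ioo 0 1))]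
  refine tendsto_integral_of_dominated_convergence (fun t => ‖g t‖) (fun k => ?_) hg.norm
    (fun k => ?_) ((ae_restrict_iff' measurableSet_Ioo).2 (Eventually.of_forall hlim))
  · exact (Measurable.aestronglyMeasurable (by fun_prop)).mul hg.aestronglyMeasurable
  · refine (ae_restrict_iff' measurableSet_Ioo).2 (Eventually.of_forall fun t ht => ?_)
    rw [norm_mul, hnorm t ht k]
    exact mul_le_of_le_one_left (norm_nonneg _) (pow_le_one₀ (Real.rpow_nonneg ht.1.le _)
      (Real.rpow_le_one ht.1.le ht.2.le hα.le))

theorem tendsto_Gamma_div_Gamma_add {α s δ : ℂ} (hα : 0 < α.re) (hs : 0 < s.re) (hδ : 0 < δ.re) :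
    Tendsto (fun k : ℕ => Complex.Gamma (α * k + s) / Complex.Gamma (α * k + s + δ))
      atTop (nhds 0) := by
  have hre : ∀ k : ℕ, 0 < (α * k + s).re := fun k => by
    rw [Complex.add_re, ← Complex.ofReal_natCast, Complex.re_mul_ofReal]
    positivity
  have h := (tendsto_integral_cpow_mul hα (integrableOn_beta hs hδ)).mul_const (Complex.Gamma δ)⁻¹
  rw [zero_mul] at h
  refine h.congr fun k => ?_
  have hbeta : ∫ t in Ioo (0 : ℝ) 1,
      (t : ℂ) ^ (α * k) * ((t : ℂ) ^ (s - 1) * ((1 - t : ℝ) : ℂ) ^ (δ - 1)) =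
        Complex.Gamma (α * k + s) * Complex.Gamma δ / Complex.Gamma (α * k + s + δ) := by
    rw [← integral_beta (hre k) hδ]
    refine setIntegral_congr_fun measurableSet_Ioo fun t ht => ?_
    rw [← mul_assoc, ← ofReal_cpow_add ht.1, add_sub_assoc]
  rw [hbeta, mul_div_right_comm, mul_inv_cancel_right₀ (Complex.Gamma_ne_zero_of_re_pos hδ)]

theorem summable_pow_div_Gamma_mul_Gamma {α r s : ℂ} (hα : 0 < α.re) (hr : 0 < r.re)
    (hs : 0 < s.re) (z : ℂ) :
    Summable fun k : ℕ => z ^ k / (Complex.Gamma (α * k + r) * Complex.Gamma (α * k + s)) := by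
  have hlim := (((tendsto_Gamma_div_Gamma_add hα hr hα).mul
    (tendsto_Gamma_div_Gamma_add hα hs hα)).const_mul z).norm
  rw [mul_zero, mul_zero, norm_zero] at hlim
  refine summable_of_ratio_norm_eventually_le (r := 1 / 2) (by norm_num) ?_
  filter_upwards [hlim.eventually (gt_mem_nhds (by norm_num : (0 : ℝ) < 1 / 2))] with k hk
  have hΓ : ∀ u : ℂ, 0 < u.re → Complex.Gamma (α * k + u) ≠ 0 := fun u hu =>
    Complex.Gamma_ne_zero_of_re_pos (by
      rw [Complex.add_re, ← Complex.ofReal_natCast, Complex.re_mul_ofReal]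
      positivity)
  have hstep : ∀ u : ℂ, α * (k + 1 : ℕ) + u = α * k + u + α := fun u => by push_cast; ring
  have hratio : z ^ (k + 1) / (Complex.Gamma (α * (k + 1 : ℕ) + r) *
      Complex.Gamma (α * (k + 1 : ℕ) + s)) =
      z * (Complex.Gamma (α * k + r) / Complex.Gamma (α * k + r + α) *
        (Complex.Gamma (α * k + s) / Complex.Gamma (α * k + s + α))) *
      (z ^ k / (Complex.Gamma (α * k + r) * Complex.Gamma (α * k + s))) := by
    rw [hstep, hstep, pow_succ']
    field_simp [hΓ r hr, hΓ s hs]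
  rw [hratio, norm_mul]
  exact mul_le_mul_of_nonneg_right hk.le (norm_nonneg _)

/-! ### Euler integrals of hypergeometric functions -/

theorem hasSum_ascPochhammer_binomial (a : ℂ) {w : ℂ} (hw : ‖w‖ < 1) :
    HasSum (fun n : ℕ => (n.factorial : ℂ)⁻¹ * (ascPochhammer ℂ n).eval a * w ^ n)
      ((1 - w) ^ (-a)) := by
  have hone : ∀ k : ℕ, (k : ℂ) ≠ -1 := fun k hk =>
    ne_neg_natCast_of_re_pos (s := 1) (by norm_num) k (by rw [hk, neg_neg])
  have h := (Complex.one_add_cpow_hasFPowerSeriesOnBall_zero (a := -a)).hasSum (y := -w)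
    (by rw [← ENNReal.ofReal_one, Metric.eball_ofReal]; simpa using hw)
  rw [binomialSeries_eq_ordinaryHypergeometricSeries hone, zero_add, ← sub_eq_add_neg] at h
  convert! h using 2 with n
  have hn : (ascPochhammer ℂ n).eval (1 : ℂ) ≠ 0 := by
    rw [Ne, ascPochhammer_eval_eq_zero_iff]
    rintro ⟨k, -, hk⟩
    exact hone k hk
  have hneg : ⇑(-ContinuousLinearMap.id ℂ ℂ) ∘ (fun _ : Fin n => -w) = fun _ => w := by
    ext; simp
  simp only [neg_neg, FormalMultilinearSeries.compContinuousLinearMap_apply]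
  rw [hneg, ordinaryHypergeometricSeries_apply_eq, smul_eq_mul, mul_inv_cancel_right₀ hn]

/-- Euler's integral `∫₀¹ t^(b - 1) (1 - t)^(c - b - 1) (1 - z t)^(-a) dt`, which for
`0 < Re b < Re c` represents `₂F₁(a, b; c; z)` up to Gamma factors, on the whole ray `z < 1`. -/
noncomputable def eulerIntegral (a b c : ℂ) (z : ℝ) : ℂ :=
  ∫ t in Ioo (0 : ℝ) 1, (t : ℂ) ^ (b - 1) * ((1 - t : ℝ) : ℂ) ^ (c - b - 1) *
    ((1 - z * t : ℝ) : ℂ) ^ (-a)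

/-- The `n`-th term of the expansion of the integrand of `eulerIntegral a b c z` in powers of `z`,
used to integrate that expansion term by term. -/
noncomputable def eulerIntegrandTerm (a b c : ℂ) (z : ℝ) (n : ℕ) (t : ℝ) : ℂ :=
  (n.factorial : ℂ)⁻¹ * (ascPochhammer ℂ n).eval a * (z : ℂ) ^ n *
    ((t : ℂ) ^ (b + n - 1) * ((1 - t : ℝ) : ℂ) ^ (c - b - 1))

theorem eulerIntegrandTerm_eq (a b c : ℂ) (z : ℝ) (n : ℕ) {t : ℝ} (ht : 0 < t) :
    eulerIntegrandTerm a b c z n t = (t : ℂ) ^ (b - 1) * ((1 - t : ℝ) : ℂ) ^ (c - b - 1) *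
      ((n.factorial : ℂ)⁻¹ * (ascPochhammer ℂ n).eval a * (z * t : ℂ) ^ n) := by
  rw [eulerIntegrandTerm, show b + n - 1 = (b - 1) + n by ring, ofReal_cpow_add ht,
    Complex.cpow_natCast, mul_pow]
  ring

theorem hasSum_eulerIntegrandTerm (a b c : ℂ) {z t : ℝ} (hz : |z| < 1) (ht : t ∈ Ioo (0 : ℝ) 1) :
    HasSum (fun n => eulerIntegrandTerm a b c z n t) ((t : ℂ) ^ (b - 1) *
      ((1 - t : ℝ) : ℂ) ^ (c - b - 1) * ((1 - z * t : ℝ) : ℂ) ^ (-a)) := by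
  have hzt : ‖(z * t : ℂ)‖ < 1 := by
    rw [norm_mul, Complex.norm_real, Complex.norm_real, Real.norm_eq_abs,
      Real.norm_of_nonneg ht.1.le]
    exact (mul_le_of_le_one_right (abs_nonneg z) ht.2.le).trans_lt hz
  simp only [eulerIntegrandTerm_eq a b c z _ ht.1]
  push_cast
  exact (hasSum_ascPochhammer_binomial a hzt).mul_left _

section

variable (a : ℂ) {b c : ℂ}

theorem eulerIntegrandTerm_integrableOn (hb : 0 < b.re) (hcb : 0 < (c - b).re) (z : ℝ) (n : ℕ) :
    IntegrableOn (eulerIntegrandTerm a b c z n) (Ioo 0 1) :=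
  (integrableOn_beta (re_add_natCast_pos hb n) hcb).const_mul _

theorem integral_eulerIntegrandTerm (hb : 0 < b.re) (hcb : 0 < (c - b).re) (z : ℝ) (n : ℕ) :
    ∫ t in Ioo (0 : ℝ) 1, eulerIntegrandTerm a b c z n t =
      Complex.Gamma b * Complex.Gamma (c - b) / Complex.Gamma c *
        ((n.factorial : ℂ)⁻¹ * (ascPochhammer ℂ n).eval a * (ascPochhammer ℂ n).eval b *
          ((ascPochhammer ℂ n).eval c)⁻¹ * (z : ℂ) ^ n) := by
  have hc : 0 < c.re := by rw [Complex.sub_re] at hcb; linarith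
  have hΓb := Complex.Gamma_ne_zero_of_re_pos hb
  have hΓc := Complex.Gamma_ne_zero_of_re_pos hc
  have hΓcn := Complex.Gamma_ne_zero_of_re_pos (re_add_natCast_pos hc n)
  simp only [eulerIntegrandTerm]
  rw [integral_const_mul, integral_beta (re_add_natCast_pos hb n) hcb,
    ← Complex.Gamma_add_nat_div_Gamma_eq b (ne_neg_natCast_of_re_pos hb),
    ← Complex.Gamma_add_nat_div_Gamma_eq c (ne_neg_natCast_of_re_pos hc),
    show b + (n : ℂ) + (c - b) = c + n by ring]
  field_simp

theorem summable_integral_norm_eulerIntegrandTerm (hb : 0 < b.re) (hcb : 0 < (c - b).re) {z : ℝ}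
    (hz : |z| < 1) :
    Summable fun n => ∫ t in Ioo (0 : ℝ) 1, ‖eulerIntegrandTerm a b c z n t‖ := by
  have hz' : ‖(z : ℂ)‖ < 1 := by rwa [Complex.norm_real]
  refine Summable.of_nonneg_of_le (fun n => integral_nonneg fun t => norm_nonneg _) (fun n => ?_)
    ((hasSum_ascPochhammer_binomial a hz').summable.norm.mul_left
      (∫ t in Ioo (0 : ℝ) 1, ‖(t : ℂ) ^ (b - 1) * ((1 - t : ℝ) : ℂ) ^ (c - b - 1)‖))
  rw [← integral_mul_const]
  refine setIntegral_mono_on (eulerIntegrandTerm_integrableOn a hb hcb z n).norm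
    ((integrableOn_beta hb hcb).norm.mul_const _) measurableSet_Ioo fun t ht => ?_
  rw [eulerIntegrandTerm_eq a b c z n ht.1, norm_mul]
  refine mul_le_mul_of_nonneg_left ?_ (norm_nonneg _)
  rw [norm_mul, norm_mul _ ((z : ℂ) ^ n), mul_pow, norm_mul ((z : ℂ) ^ n), norm_pow (t : ℂ),
    Complex.norm_real, Real.norm_of_nonneg ht.1.le]
  exact mul_le_mul_of_nonneg_left (mul_le_of_le_one_right (norm_nonneg _)
    (pow_le_one₀ ht.1.le ht.2.le)) (norm_nonneg _)

theorem ordinaryHypergeometric_eq_eulerIntegral (hb : 0 < b.re) (hcb : 0 < (c - b).re) {z : ℝ}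
    (hz : |z| < 1) :
    ordinaryHypergeometric a b c (z : ℂ) =
      Complex.Gamma c / (Complex.Gamma b * Complex.Gamma (c - b)) * eulerIntegral a b c z := by
  have hc : 0 < c.re := by rw [Complex.sub_re] at hcb; linarith
  have hΓb := Complex.Gamma_ne_zero_of_re_pos hb
  have hΓc := Complex.Gamma_ne_zero_of_re_pos hc
  have hΓcb := Complex.Gamma_ne_zero_of_re_pos hcb
  have hseries := hasSum_integral_of_summable_integral_norm
    (eulerIntegrandTerm_integrableOn a hb hcb z)
    (summable_integral_norm_eulerIntegrandTerm a hb hcb hz)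
  have hpointwise : ∫ t in Ioo (0 : ℝ) 1, ∑' n, eulerIntegrandTerm a b c z n t =
      eulerIntegral a b c z :=
    setIntegral_congr_fun measurableSet_Ioo fun t ht =>
      (hasSum_eulerIntegrandTerm a b c hz ht).tsum_eq
  rw [hpointwise] at hseries
  simp only [integral_eulerIntegrandTerm a hb hcb] at hseries
  rw [← hseries.tsum_eq, tsum_mul_left, ordinaryHypergeometric_eq_tsum]
  simp only [smul_eq_mul]
  field_simp

end

theorem integral_Ioo_comp_one_sub (f : ℝ → ℂ) :
    ∫ t in Ioo (0 : ℝ) 1, f (1 - t) = ∫ t in Ioo (0 : ℝ) 1, f t := by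
  have h := intervalIntegral.integral_comp_sub_left (a := 0) (b := 1) f 1
  simpa [intervalIntegral.integral_of_le zero_le_one, integral_Ioc_eq_integral_Ioo] using h

/-- The substitution is an involution of the unit interval. -/
theorem integral_Ioo_comp_moebius {z : ℝ} (hz : z < 1) (f : ℝ → ℂ) :
    ∫ s in Ioo (0 : ℝ) 1, (((1 - z) / (1 - z * s) ^ 2 : ℝ) : ℂ) * f ((1 - s) / (1 - z * s)) =
      ∫ t in Ioo (0 : ℝ) 1, f t := by
  have hden : ∀ s ∈ Ioo (0 : ℝ) 1, 0 < 1 - z * s := fun s hs => by nlinarith [hs.1, hs.2]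
  have hmaps : MapsTo (fun s : ℝ => (1 - s) / (1 - z * s)) (Ioo 0 1) (Ioo 0 1) := fun s hs =>
    ⟨div_pos (by linarith [hs.2]) (hden s hs),
      (div_lt_one (hden s hs)).2 (by nlinarith [hs.1])⟩
  have hinv : LeftInvOn (fun s : ℝ => (1 - s) / (1 - z * s)) (fun s => (1 - s) / (1 - z * s))
      (Ioo 0 1) := fun s hs => by
    have h0 := (hden s hs).ne'
    have h1 : 1 - z * s - z * (1 - s) ≠ 0 := by linarith
    simp only
    rw [one_sub_div h0, mul_div_assoc', one_sub_div h0, div_div_div_cancel_right₀ h0, div_eq_iff h1]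
    ring
  have himage : (fun s : ℝ => (1 - s) / (1 - z * s)) '' Ioo 0 1 = Ioo 0 1 :=
    subset_antisymm hmaps.image_subset (hinv.surjOn hmaps)
  have hderiv : ∀ s ∈ Ioo (0 : ℝ) 1, HasDerivWithinAt (fun s : ℝ => (1 - s) / (1 - z * s))
      (-((1 - z) / (1 - z * s) ^ 2)) (Ioo 0 1) s := fun s hs => by
    have h := ((hasDerivAt_id s).const_sub 1).div
      (((hasDerivAt_id s).const_mul z).const_sub 1) (hden s hs).ne'
    refine (h.congr_deriv ?_).hasDerivWithinAt
    simp only [id_eq]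
    ring
  have h := integral_image_eq_integral_abs_deriv_smul measurableSet_Ioo hderiv hinv.injOn f
  rw [himage] at h
  rw [h]
  refine setIntegral_congr_fun measurableSet_Ioo fun s _ => ?_
  have hpos : 0 ≤ (1 - z) / (1 - z * s) ^ 2 := div_nonneg (by linarith) (sq_nonneg _)
  simp only [abs_neg, abs_of_nonneg hpos, Complex.real_smul]

theorem eulerIntegral_pfaff (a b c : ℂ) {z : ℝ} (hz : z < 1) :
    eulerIntegral a (c - b) c (z / (z - 1)) =
      ((1 - z : ℝ) : ℂ) ^ a * eulerIntegral a b c z := by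
  rw [eulerIntegral, eulerIntegral, ← integral_Ioo_comp_one_sub, ← integral_const_mul]
  refine setIntegral_congr_fun measurableSet_Ioo fun t ht => ?_
  have h1 : 0 < 1 - z := by linarith
  have h2 : 0 < 1 - z * t := by nlinarith [ht.1, ht.2]
  have hbase : 1 - z / (z - 1) * (1 - t) = (1 - z * t) / (1 - z) := by
    have hz1 : z - 1 ≠ 0 := by linarith
    field_simp
    ring
  rw [hbase, sub_sub_cancel, sub_sub_cancel, ofReal_cpow_eq_exp h1,
    ofReal_cpow_eq_exp (div_pos h2 h1), ofReal_cpow_eq_exp h2, Real.log_div h2.ne' h1.ne',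
    mul_left_comm (Complex.exp _), ← Complex.exp_add, mul_comm (((1 - t : ℝ) : ℂ) ^ _)]
  congr 2
  push_cast
  ring

theorem eulerIntegral_euler (a b c : ℂ) {z : ℝ} (hz : z < 1) :
    eulerIntegral a b c z =
      ((1 - z : ℝ) : ℂ) ^ (c - a - b) * eulerIntegral (c - a) (c - b) c z := by
  rw [eulerIntegral, eulerIntegral, ← integral_Ioo_comp_moebius hz, ← integral_const_mul]
  refine setIntegral_congr_fun measurableSet_Ioo fun t ht => ?_
  have h0 := ht.1
  have h1 : 0 < 1 - z := by linarith
  have h2 : 0 < 1 - z * t := by nlinarith [ht.1, ht.2]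
  have h3 : 0 < 1 - t := by linarith [ht.2]
  have e1 : 1 - (1 - t) / (1 - z * t) = t * (1 - z) / (1 - z * t) := by
    rw [one_sub_div h2.ne']; ring
  have e2 : 1 - z * ((1 - t) / (1 - z * t)) = (1 - z) / (1 - z * t) := by
    rw [mul_div_assoc', one_sub_div h2.ne']; ring
  have e3 : (((1 - z) / (1 - z * t) ^ 2 : ℝ) : ℂ) =
      Complex.exp (Real.log (1 - z) - 2 * Real.log (1 - z * t)) := by
    rw [← Complex.cpow_one (((1 - z) / (1 - z * t) ^ 2 : ℝ) : ℂ),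
      ofReal_cpow_eq_exp (by positivity), Real.log_div h1.ne' (by positivity), Real.log_pow]
    push_cast
    ring_nf
  rw [e1, e2, e3, ofReal_cpow_eq_exp h0, ofReal_cpow_eq_exp h1, ofReal_cpow_eq_exp h2,
    ofReal_cpow_eq_exp h3, ofReal_cpow_eq_exp (div_pos h3 h2),
    ofReal_cpow_eq_exp (div_pos (mul_pos h0 h1) h2), ofReal_cpow_eq_exp (div_pos h1 h2),
    Real.log_div h3.ne' h2.ne', Real.log_div (by positivity) h2.ne',
    Real.log_div h1.ne' h2.ne', Real.log_mul h0.ne' h1.ne']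
  simp only [← Complex.exp_add]
  congr 1
  push_cast
  ring

theorem ordinaryHypergeometric_comm (a b c z : ℂ) :
    ordinaryHypergeometric a b c z = ordinaryHypergeometric b a c z := by
  rw [ordinaryHypergeometric, ordinaryHypergeometricSeries_symm, ← ordinaryHypergeometric]

theorem abs_div_sub_one_lt_one {z : ℝ} (hz : z < 1) (hz' : ¬|z| < 1) : |z / (z - 1)| < 1 := by
  have hz1 : z ≤ -1 := by
    rcases le_abs.1 (not_lt.1 hz') with h | h <;> linarith
  rw [abs_div, div_lt_one (abs_pos.2 (by linarith)), abs_of_neg (by linarith),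
    abs_of_neg (by linarith)]
  linarith

theorem gaussHyp_eq_eulerIntegral (a : ℂ) {b c : ℂ} (hb : 0 < b.re) (hcb : 0 < (c - b).re) {z : ℝ}
    (hz : z < 1) :
    gaussHyp a b c z =
      Complex.Gamma c / (Complex.Gamma b * Complex.Gamma (c - b)) * eulerIntegral a b c z := by
  rw [gaussHyp]
  split_ifs with h
  · exact ordinaryHypergeometric_eq_eulerIntegral a hb hcb h
  · have h1 : ((1 - z : ℝ) : ℂ) ≠ 0 := by exact_mod_cast (sub_pos.2 hz).ne'
    rw [ordinaryHypergeometric_eq_eulerIntegral a hcb (by rwa [sub_sub_cancel])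
      (abs_div_sub_one_lt_one hz h), eulerIntegral_pfaff a b c hz, sub_sub_cancel,
      mul_left_comm, ← mul_assoc (_ ^ (-a)), ← Complex.cpow_add _ _ h1, neg_add_cancel,
      Complex.cpow_zero, one_mul, mul_comm (Complex.Gamma b)]

theorem gaussHyp_eq_eulerIntegral_swap {a c : ℂ} (b : ℂ) (ha : 0 < a.re) (hca : 0 < (c - a).re)
    {z : ℝ} (hz : z < 1) :
    gaussHyp a b c z =
      Complex.Gamma c / (Complex.Gamma a * Complex.Gamma (c - a)) * eulerIntegral b a c z := by
  rw [gaussHyp]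
  split_ifs with h
  · rw [ordinaryHypergeometric_comm, ordinaryHypergeometric_eq_eulerIntegral b ha hca h]
  · have h1 : ((1 - z : ℝ) : ℂ) ≠ 0 := by exact_mod_cast (sub_pos.2 hz).ne'
    have hpfaff := eulerIntegral_pfaff (c - b) (c - a) c hz
    rw [sub_sub_cancel] at hpfaff
    rw [ordinaryHypergeometric_comm, ordinaryHypergeometric_eq_eulerIntegral (c - b) ha hca
      (abs_div_sub_one_lt_one hz h), hpfaff, eulerIntegral_euler b a c hz, mul_left_comm,
      ← mul_assoc (_ ^ (-a)), ← Complex.cpow_add _ _ h1, neg_add_eq_sub]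
/-! ### Changes of variables on intervals -/

theorem abs_sub_mul_integral_comp_affine {a b : ℝ} (hab : a ≠ b) (g : ℝ → ℂ) :
    ((|b - a| : ℝ) : ℂ) * ∫ t in Ioo (0 : ℝ) 1, g (b + (a - b) * t) = ∫ s in uIoo a b, g s := by
  have hlt : ∀ {a b : ℝ}, a < b → ∀ g : ℝ → ℂ,
      ((b - a : ℝ) : ℂ) * ∫ t in Ioo (0 : ℝ) 1, g (a + (b - a) * t) = ∫ s in Ioo a b, g s := by
    intro a b hab g
    have hne : ((b - a : ℝ) : ℂ) ≠ 0 := by exact_mod_cast (sub_pos.2 hab).ne'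
    have h := intervalIntegral.integral_comp_add_mul (a := 0) (b := 1) g (sub_pos.2 hab).ne' a
    rw [intervalIntegral.integral_of_le zero_le_one, integral_Ioc_eq_integral_Ioo] at h
    rw [h, mul_zero, add_zero, mul_one, add_sub_cancel, intervalIntegral.integral_of_le hab.le,
      integral_Ioc_eq_integral_Ioo, Complex.real_smul, Complex.ofReal_inv,
      mul_inv_cancel_left₀ hne]
  rcases hab.lt_or_gt with h | h
  · rw [abs_of_pos (sub_pos.2 h), uIoo_of_lt h, ← hlt h, ← integral_Ioo_comp_one_sub]
    congr! 3 with t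
    ring_nf
  · rw [abs_of_neg (sub_neg.2 h), neg_sub, uIoo_of_gt h, hlt h]

theorem integral_Ioo_comp_sq {a b : ℝ} (ha : 0 ≤ a) (hab : a ≤ b) (g : ℝ → ℂ) :
    ∫ s in Ioo a b, ((2 * s : ℝ) : ℂ) * g (s ^ 2) = ∫ r in Ioo (a ^ 2) (b ^ 2), g r := by
  have hmono : StrictMonoOn (fun s : ℝ => s ^ 2) (Icc a b) :=
    (pow_left_strictMonoOn₀ two_ne_zero).mono fun s hs => ha.trans hs.1
  rw [← ContinuousOn.image_Ioo_of_strictMonoOn hab (by fun_prop) hmono,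
    integral_image_eq_integral_abs_deriv_smul measurableSet_Ioo (f' := fun s => 2 * s)
      (fun s _ => by simpa using (hasDerivAt_pow 2 s).hasDerivWithinAt)
      (hmono.injOn.mono Ioo_subset_Icc_self)]
  refine setIntegral_congr_fun measurableSet_Ioo fun s hs => ?_
  rw [abs_of_pos (mul_pos two_pos (ha.trans_lt hs.1)), Complex.real_smul]

theorem continuousOn_const_div_Icc {a : ℝ} (ha : 0 < a) (b c : ℝ) :
    ContinuousOn (fun s : ℝ => c / s) (Icc a b) :=
  continuousOn_const.div continuousOn_id fun _ hs => (ha.trans_le hs.1).ne'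

theorem integral_Ioo_comp_mul_div {a b : ℝ} (ha : 0 < a) (hab : a ≤ b) (g : ℝ → ℂ) :
    ∫ s in Ioo a b, ((a * b / s ^ 2 : ℝ) : ℂ) * g (a * b / s) = ∫ s in Ioo a b, g s := by
  have hb := ha.trans_le hab
  have hanti : StrictAntiOn (fun s : ℝ => a * b / s) (Icc a b) := fun s hs t _ hst =>
    div_lt_div_of_pos_left (mul_pos ha hb) (ha.trans_le hs.1) hst
  have himage := (continuousOn_const_div_Icc ha b (a * b)).image_Ioo_of_strictAntiOn hab hanti
  rw [mul_div_cancel_right₀ a hb.ne', mul_div_cancel_left₀ b ha.ne'] at himage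
  have hderiv : ∀ s ∈ Ioo a b, HasDerivWithinAt (fun s : ℝ => a * b / s) (-(a * b / s ^ 2))
      (Ioo a b) s := fun s hs =>
    (((hasDerivAt_inv (ha.trans hs.1).ne').const_mul (a * b)).congr_deriv
      (by ring)).hasDerivWithinAt
  have h := integral_image_eq_integral_abs_deriv_smul measurableSet_Ioo hderiv
    (hanti.injOn.mono Ioo_subset_Icc_self) g
  rw [himage] at h
  rw [h]
  refine setIntegral_congr_fun measurableSet_Ioo fun s _ => ?_
  have hpos : 0 ≤ a * b / s ^ 2 := by positivity
  simp only [abs_neg, abs_of_nonneg hpos, Complex.real_smul]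

theorem hasDerivWithinAt_sub_div {s : ℝ} (hs : s ≠ 0) (c : ℝ) (S : Set ℝ) :
    HasDerivWithinAt (fun s : ℝ => s - c / s) (1 + c / s ^ 2) S s :=
  (((hasDerivAt_id s).sub ((hasDerivAt_inv hs).const_mul c)).congr_deriv
    (by ring)).hasDerivWithinAt

section

variable {a b : ℝ} (ha : 0 < a) (hab : a ≤ b)

include ha hab

theorem strictMonoOn_sub_mul_div : StrictMonoOn (fun s : ℝ => s - a * b / s) (Icc a b) :=
  fun _ hs _ _ hst => sub_lt_sub hst
    (div_lt_div_of_pos_left (mul_pos ha (ha.trans_le hab)) (ha.trans_le hs.1) hst)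

theorem image_sub_mul_div_Ioo :
    (fun s : ℝ => s - a * b / s) '' Ioo a b = Ioo (-(b - a)) (b - a) := by
  have hcont := continuousOn_id.sub (continuousOn_const_div_Icc ha b (a * b))
  have h := hcont.image_Ioo_of_strictMonoOn hab (strictMonoOn_sub_mul_div ha hab)
  simp only [Pi.sub_apply, id_eq] at h
  rwa [mul_div_cancel_right₀ a (ha.trans_le hab).ne', mul_div_cancel_left₀ b ha.ne',
    ← neg_sub b a] at h

theorem integrableOn_comp_sub_mul_div {g : ℝ → ℂ} (hg : IntegrableOn g (Ioo (-(b - a)) (b - a))) :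
    IntegrableOn (fun s => g (s - a * b / s)) (Ioo a b) := by
  have hb := ha.trans_le hab
  rw [← image_sub_mul_div_Ioo ha hab,
    integrableOn_image_iff_integrableOn_abs_deriv_smul measurableSet_Ioo
      (fun s hs => hasDerivWithinAt_sub_div (ha.trans hs.1).ne' _ _)
      ((strictMonoOn_sub_mul_div ha hab).injOn.mono Ioo_subset_Icc_self)] at hg
  have hfactor : Measurable fun s : ℝ => (1 + a * b / s ^ 2)⁻¹ := by fun_prop
  refine (hg.bdd_mul (c := 1) hfactor.complex_ofReal.aestronglyMeasurable
    (Eventually.of_forall fun s => ?_)).congr (Eventually.of_forall fun s => ?_)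
  · rw [Complex.norm_real, Real.norm_of_nonneg (by positivity)]
    exact inv_le_one_of_one_le₀ (le_add_of_nonneg_right (by positivity))
  · have hpos : 0 < 1 + a * b / s ^ 2 := by positivity
    have hne : ((1 + a * b / s ^ 2 : ℝ) : ℂ) ≠ 0 := by exact_mod_cast hpos.ne'
    simp only [abs_of_pos hpos, Complex.real_smul, Complex.ofReal_inv]
    rw [inv_mul_cancel_left₀ hne]

/-- The Cauchy-Schlömilch substitution `u = s - ab/s`: the swap `s ↦ ab/s` turns the part `ab/s²`
of the derivative `1 + ab/s²` into the part `1`. -/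
theorem integral_Ioo_comp_sub_mul_div {g : ℝ → ℂ} (hg : IntegrableOn g (Ioo (-(b - a)) (b - a)))
    (heven : ∀ u, g (-u) = g u) :
    2 * ∫ s in Ioo a b, g (s - a * b / s) = ∫ u in Ioo (-(b - a)) (b - a), g u := by
  have hb := ha.trans_le hab
  have hint := integrableOn_comp_sub_mul_div ha hab hg
  have hg' := hg
  rw [← image_sub_mul_div_Ioo ha hab,
    integrableOn_image_iff_integrableOn_abs_deriv_smul measurableSet_Ioo
      (fun s hs => hasDerivWithinAt_sub_div (ha.trans hs.1).ne' _ _)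
      ((strictMonoOn_sub_mul_div ha hab).injOn.mono Ioo_subset_Icc_self)] at hg'
  have hsplit : ∀ s : ℝ, |1 + a * b / s ^ 2| • g (s - a * b / s) =
      g (s - a * b / s) + ((a * b / s ^ 2 : ℝ) : ℂ) * g (s - a * b / s) := fun s => by
    have hpos : 0 ≤ 1 + a * b / s ^ 2 := by positivity
    rw [abs_of_nonneg hpos, Complex.real_smul]
    push_cast
    ring
  simp only [hsplit] at hg'
  have hswap : ∫ s in Ioo a b, ((a * b / s ^ 2 : ℝ) : ℂ) * g (s - a * b / s) =
      ∫ s in Ioo a b, g (s - a * b / s) := by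
    rw [← integral_Ioo_comp_mul_div ha hab fun s => g (s - a * b / s)]
    refine setIntegral_congr_fun measurableSet_Ioo fun s _ => ?_
    rw [← heven, neg_sub, div_div_cancel₀ (mul_pos ha hb).ne']
  have hrest := hg'.sub hint
  simp only [Pi.sub_def, add_sub_cancel_left] at hrest
  rw [← image_sub_mul_div_Ioo ha hab,
    integral_image_eq_integral_abs_deriv_smul measurableSet_Ioo
      (fun s hs => hasDerivWithinAt_sub_div (ha.trans hs.1).ne' _ _)
      ((strictMonoOn_sub_mul_div ha hab).injOn.mono Ioo_subset_Icc_self)]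
  simp only [hsplit]
  rw [integral_add hint hrest, hswap, two_mul]

end

theorem integrableOn_beta_scaled {u v : ℂ} (hu : 0 < u.re) (hv : 0 < v.re) {S : ℝ} (hS : 0 < S) :
    IntegrableOn (fun y : ℝ => (y : ℂ) ^ (u - 1) * ((S - y : ℝ) : ℂ) ^ (v - 1)) (Ioo 0 S) := by
  have h := (Complex.betaIntegral_convergent hu hv).comp_mul_left (c := S⁻¹)
  rw [zero_div, one_div, inv_inv, intervalIntegrable_iff_integrableOn_Ioo_of_le hS.le] at h
  refine IntegrableOn.congr_fun (h.const_mul ((S : ℂ) ^ (u - 1) * (S : ℂ) ^ (v - 1)))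
    (fun y hy => ?_) measurableSet_Ioo
  have h1 : 0 < S - y := sub_pos.2 hy.2
  have hbase : (1 : ℂ) - ((S⁻¹ * y : ℝ) : ℂ) = ((S⁻¹ * (S - y) : ℝ) : ℂ) := by
    rw [mul_sub, inv_mul_cancel₀ hS.ne']
    push_cast
    rfl
  rw [hbase, mul_mul_mul_comm,
    ← Complex.mul_cpow_ofReal_nonneg hS.le (mul_nonneg (inv_nonneg.2 hS.le) hy.1.le),
    ← Complex.mul_cpow_ofReal_nonneg hS.le (by positivity), ← Complex.ofReal_mul,
    ← Complex.ofReal_mul, mul_inv_cancel_left₀ hS.ne', mul_inv_cancel_left₀ hS.ne']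

theorem integral_beta_scaled {u v : ℂ} (hu : 0 < u.re) (hv : 0 < v.re) {S : ℝ} (hS : 0 < S) :
    ∫ y in Ioo 0 S, (y : ℂ) ^ (u - 1) * ((S - y : ℝ) : ℂ) ^ (v - 1) =
      (S : ℂ) ^ (u + v - 1) * (Complex.Gamma u * Complex.Gamma v / Complex.Gamma (u + v)) := by
  rw [← Complex.betaIntegral_eq_Gamma_mul_div u v hu hv, ← Complex.betaIntegral_scaled u v hS,
    intervalIntegral.integral_of_le hS.le, integral_Ioc_eq_integral_Ioo]
  simp only [Complex.ofReal_sub]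

/-! ### Kernels of Bessel fractional integration -/

section

variable {ν : ℝ} {α β : ℂ}

theorem re_pos_of_half_lt (hν : ν < 1) (hα : (1 - ν) / 2 < α.re) : 0 < α.re := by linarith

theorem half_sub_one_re (ν : ℝ) : (((ν : ℂ) - 1) / 2).re = (ν - 1) / 2 := by
  rw [← Complex.ofReal_one, ← Complex.ofReal_sub, Complex.div_ofNat_re, Complex.ofReal_re]

theorem re_add_half_pos (hα : (1 - ν) / 2 < α.re) : 0 < (α + ((ν : ℂ) - 1) / 2).re := by
  rw [Complex.add_re, half_sub_one_re]
  linarith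

theorem re_sub_half_pos (hν : ν < 1) (hα : (1 - ν) / 2 < α.re) :
    0 < (α - ((ν : ℂ) - 1) / 2).re := by
  rw [Complex.sub_re, half_sub_one_re]
  linarith

theorem mul_natCast_re (α : ℂ) (n : ℕ) : (α * n).re = α.re * n := by
  rw [← Complex.ofReal_natCast, Complex.re_mul_ofReal]

theorem re_le_mul_succ_re (hα : 0 ≤ α.re) (k : ℕ) : α.re ≤ (α * (k + 1 : ℕ)).re := by
  rw [mul_natCast_re]
  exact le_mul_of_one_le_right hα (by simp)

/-- The coefficient `1 / (Γ(β + (ν - 1)/2) Γ(β - (ν - 1)/2))` of the series `S_{α,ν}`, where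
`β = αk`. -/
noncomputable def besselCoeff (ν : ℝ) (β : ℂ) : ℂ :=
  (Complex.Gamma (β + ((ν : ℂ) - 1) / 2) * Complex.Gamma (β - ((ν : ℂ) - 1) / 2))⁻¹

theorem besselWrightTerm_eq (α : ℂ) (ν : ℝ) (z : ℂ) (k : ℕ) :
    besselWrightTerm α ν z k = besselCoeff ν (α * k) * z ^ k := by
  rw [besselWrightTerm, besselCoeff, div_eq_inv_mul]

theorem besselWrightTerm_summable (hν : ν < 1) (hα : (1 - ν) / 2 < α.re) (z : ℂ) :
    Summable fun k : ℕ => besselWrightTerm α ν z (k + 1) := by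
  refine ((summable_pow_div_Gamma_mul_Gamma (re_pos_of_half_lt hν hα) (re_add_half_pos hα)
    (re_sub_half_pos hν hα) z).mul_left z).congr fun k => ?_
  rw [besselWrightTerm, Nat.cast_succ, mul_add_one α (k : ℂ), add_assoc, add_sub_assoc, pow_succ',
    mul_div_assoc]

/-- The quantity `|p² - q²| / (2q)` whose powers give the size of the kernels. -/
noncomputable def besselGap (p q : ℝ) : ℝ := |p ^ 2 - q ^ 2| / (2 * q)

section

variable {p q t : ℝ}

theorem abs_sq_sub_sq_pos (hp : 0 < p) (hq : 0 < q) (hpq : p ≠ q) : 0 < |p ^ 2 - q ^ 2| := by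
  rwa [abs_pos, sub_ne_zero, Ne, sq_eq_sq₀ hp.le hq.le]

theorem besselGap_pos (hp : 0 < p) (hq : 0 < q) (hpq : p ≠ q) : 0 < besselGap p q :=
  div_pos (abs_sq_sub_sq_pos hp hq hpq) (by positivity)

theorem one_sub_sq_div_sq_lt_one (hp : 0 < p) (hq : 0 < q) : 1 - p ^ 2 / q ^ 2 < 1 :=
  sub_lt_self 1 (by positivity)

theorem one_sub_le_one_sub_mul (p q : ℝ) (ht : 0 < t) :
    1 - t ≤ 1 - (1 - p ^ 2 / q ^ 2) * t := by
  have hpq : 0 ≤ p ^ 2 / q ^ 2 := by positivity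
  nlinarith

theorem one_sub_mul_pos (p q : ℝ) (ht : t ∈ Ioo (0 : ℝ) 1) :
    0 < 1 - (1 - p ^ 2 / q ^ 2) * t :=
  (sub_pos.2 ht.2).trans_le (one_sub_le_one_sub_mul p q ht.1)

/-- The part of the kernel of order `β` that is symmetric, as a function of the squares
`P = p²`, `Q = q²` of its arguments. -/
noncomputable def besselSymmPart (ν : ℝ) (β : ℂ) (P Q : ℝ) : ℂ :=
  (Complex.Gamma β * Complex.Gamma β)⁻¹ * (2 : ℂ) ^ (1 - 2 * β) *
    ∫ s in uIoo P Q, ((|P - s| : ℝ) : ℂ) ^ (β - 1) * ((|s - Q| : ℝ) : ℂ) ^ (β - 1) *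
      (s : ℂ) ^ ((1 - (ν : ℂ)) / 2 - β)

theorem besselSymmPart_comm (ν : ℝ) (β : ℂ) (P Q : ℝ) :
    besselSymmPart ν β P Q = besselSymmPart ν β Q P := by
  rw [besselSymmPart, besselSymmPart, uIoo_comm]
  simp only [abs_sub_comm P, abs_sub_comm _ Q]
  congr! 4 with s
  ring

theorem eulerIntegral_eq_integral_uIoo (a β : ℂ) (hp : 0 < p) (hq : 0 < q) (hpq : p ≠ q) :
    ((|p ^ 2 - q ^ 2| : ℝ) : ℂ) ^ (2 * β - 1) * eulerIntegral a β (2 * β) (1 - p ^ 2 / q ^ 2) =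
      (q : ℂ) ^ (2 * a) * ∫ s in uIoo (p ^ 2) (q ^ 2), ((|p ^ 2 - s| : ℝ) : ℂ) ^ (β - 1) *
        ((|s - q ^ 2| : ℝ) : ℂ) ^ (β - 1) * (s : ℂ) ^ (-a) := by
  have hd := abs_sq_sub_sq_pos hp hq hpq
  have hne : p ^ 2 ≠ q ^ 2 := sub_ne_zero.1 (abs_pos.1 hd)
  rw [eulerIntegral, ← abs_sub_mul_integral_comp_affine hne, ← integral_const_mul,
    ← integral_const_mul, ← integral_const_mul]
  refine setIntegral_congr_fun measurableSet_Ioo fun t ht => ?_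
  have h1 : 0 < 1 - t := sub_pos.2 ht.2
  have h2 : 0 < q ^ 2 + (p ^ 2 - q ^ 2) * t := by
    nlinarith [mul_pos (pow_pos hp 2) ht.1, mul_pos (pow_pos hq 2) h1]
  have hbase : 1 - (1 - p ^ 2 / q ^ 2) * t = (q ^ 2 + (p ^ 2 - q ^ 2) * t) / q ^ 2 := by
    field_simp
    ring
  have hleft : |p ^ 2 - (q ^ 2 + (p ^ 2 - q ^ 2) * t)| = |p ^ 2 - q ^ 2| * (1 - t) := by
    rw [show p ^ 2 - (q ^ 2 + (p ^ 2 - q ^ 2) * t) = (p ^ 2 - q ^ 2) * (1 - t) by ring, abs_mul,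
      abs_of_pos h1]
  have hright : |q ^ 2 + (p ^ 2 - q ^ 2) * t - q ^ 2| = |p ^ 2 - q ^ 2| * t := by
    rw [add_sub_cancel_left, abs_mul, abs_of_pos ht.1]
  have hexp : ((|p ^ 2 - q ^ 2| : ℝ) : ℂ) = Complex.exp (Real.log |p ^ 2 - q ^ 2|) := by
    rw [← Complex.ofReal_exp, Real.exp_log hd]
  rw [abs_sub_comm (q ^ 2), hbase, hleft, hright, ofReal_cpow_eq_exp hd, ofReal_cpow_eq_exp ht.1,
    ofReal_cpow_eq_exp h1, ofReal_cpow_eq_exp (div_pos h2 (by positivity)), ofReal_cpow_eq_exp hq,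
    ofReal_cpow_eq_exp (mul_pos hd h1), ofReal_cpow_eq_exp (mul_pos hd ht.1),
    ofReal_cpow_eq_exp h2, Real.log_div h2.ne' (by positivity), Real.log_mul hd.ne' h1.ne',
    Real.log_mul hd.ne' ht.1.ne', Real.log_pow, hexp]
  simp only [← Complex.exp_add]
  congr 1
  push_cast
  ring

theorem besselFracKernel_eq_symmPart (ν : ℝ) (hβ : 0 < β.re) (hp : 0 < p) (hq : 0 < q)
    (hpq : p ≠ q) :
    besselFracKernel ν β p q = ((q ^ ν : ℝ) : ℂ) * besselSymmPart ν β (p ^ 2) (q ^ 2) := by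
  have hΓ : Complex.Gamma (2 * β) ≠ 0 := Complex.Gamma_ne_zero_of_re_pos (by simpa using hβ)
  have hsub : 2 * β - β = β := by ring
  have hgap : ((|p ^ 2 - q ^ 2| / (2 * q) : ℝ) : ℂ) ^ (2 * β - 1) =
      ((|p ^ 2 - q ^ 2| : ℝ) : ℂ) ^ (2 * β - 1) *
        ((2 : ℂ) ^ (1 - 2 * β) * (q : ℂ) ^ (1 - 2 * β)) := by
    rw [← neg_sub (2 * β), Complex.cpow_neg, Complex.cpow_neg, ← mul_inv, ← div_eq_mul_inv,
      ← Complex.ofReal_ofNat, ← Complex.mul_cpow_ofReal_nonneg two_pos.le hq.le,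
      ← Complex.ofReal_mul, Complex.ofReal_div,
      Complex.div_cpow_ofReal_nonneg (abs_nonneg _) (by positivity)]
  have hpow : (q : ℂ) ^ (1 - 2 * β) * (q : ℂ) ^ (2 * (β + ((ν : ℂ) - 1) / 2)) =
      ((q ^ ν : ℝ) : ℂ) := by
    rw [← ofReal_cpow_add hq, Complex.ofReal_cpow hq.le]
    ring_nf
  have hEuler := eulerIntegral_eq_integral_uIoo (β + ((ν : ℂ) - 1) / 2) β hp hq hpq
  have hneg : -(β + ((ν : ℂ) - 1) / 2) = (1 - (ν : ℂ)) / 2 - β := by ring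
  rw [besselFracKernel, gaussHyp_eq_eulerIntegral _ hβ (by rwa [hsub])
    (one_sub_sq_div_sq_lt_one hp hq), hsub, hgap, besselSymmPart, ← hneg, ← hpow]
  calc _ = (Complex.Gamma β * Complex.Gamma β)⁻¹ * (2 : ℂ) ^ (1 - 2 * β) *
        (q : ℂ) ^ (1 - 2 * β) * (((|p ^ 2 - q ^ 2| : ℝ) : ℂ) ^ (2 * β - 1) *
          eulerIntegral (β + ((ν : ℂ) - 1) / 2) β (2 * β) (1 - p ^ 2 / q ^ 2)) := by
        field_simp
    _ = _ := by
        rw [hEuler]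
        ring

theorem besselFracKernel_symm (ν : ℝ) (hβ : 0 < β.re) (hp : 0 < p) (hq : 0 < q) (hpq : p ≠ q) :
    besselFracKernel ν β p q * ((p ^ ν : ℝ) : ℂ) =
      besselFracKernel ν β q p * ((q ^ ν : ℝ) : ℂ) := by
  rw [besselFracKernel_eq_symmPart ν hβ hp hq hpq,
    besselFracKernel_eq_symmPart ν hβ hq hp hpq.symm, besselSymmPart_comm]
  ring

end

end

section

variable {β : ℂ} {d : ℝ}

theorem sq_sub_sq_cpow_comp_sub (β : ℂ) (d : ℝ) :
    (fun v : ℝ => ((d ^ 2 - (v - d) ^ 2 : ℝ) : ℂ) ^ (β - 1)) =ᵐ[volume.restrict (Ioo 0 (2 * d))]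
      fun v => (v : ℂ) ^ (β - 1) * ((2 * d - v : ℝ) : ℂ) ^ (β - 1) := by
  refine (ae_restrict_iff' measurableSet_Ioo).2 (Eventually.of_forall fun v hv => ?_)
  beta_reduce
  rw [← Complex.mul_cpow_ofReal_nonneg hv.1.le (sub_nonneg.2 hv.2.le), ← Complex.ofReal_mul]
  ring_nf

theorem integrableOn_sq_sub_sq_cpow (hβ : 0 < β.re) (hd : 0 < d) :
    IntegrableOn (fun u : ℝ => ((d ^ 2 - u ^ 2 : ℝ) : ℂ) ^ (β - 1)) (Ioo (-d) d) := by
  have h : IntervalIntegrable (fun v : ℝ => ((d ^ 2 - (v - d) ^ 2 : ℝ) : ℂ) ^ (β - 1)) volume 0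
      (2 * d) := by
    rw [intervalIntegrable_iff_integrableOn_Ioo_of_le (by positivity), IntegrableOn,
      integrable_congr (sq_sub_sq_cpow_comp_sub β d)]
    exact integrableOn_beta_scaled hβ hβ (by positivity)
  have hshift := h.comp_add_right d
  simp only [add_sub_cancel_right] at hshift
  rwa [zero_sub, two_mul, add_sub_cancel_right,
    intervalIntegrable_iff_integrableOn_Ioo_of_le (neg_le_self hd.le)] at hshift

theorem integral_sq_sub_sq_cpow (hβ : 0 < β.re) (hd : 0 < d) :
    ∫ u in Ioo (-d) d, ((d ^ 2 - u ^ 2 : ℝ) : ℂ) ^ (β - 1) =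
      ((2 * d : ℝ) : ℂ) ^ (2 * β - 1) *
        (Complex.Gamma β * Complex.Gamma β / Complex.Gamma (2 * β)) := by
  have h := intervalIntegral.integral_comp_sub_right (a := 0) (b := 2 * d)
    (fun u : ℝ => ((d ^ 2 - u ^ 2 : ℝ) : ℂ) ^ (β - 1)) d
  rw [zero_sub, two_mul d, add_sub_cancel_right, intervalIntegral.integral_of_le (by linarith),
    intervalIntegral.integral_of_le (by linarith), integral_Ioc_eq_integral_Ioo,
    integral_Ioc_eq_integral_Ioo, ← two_mul, integral_congr_ae (sq_sub_sq_cpow_comp_sub β d),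
    integral_beta_scaled hβ hβ (by positivity), ← two_mul] at h
  exact h.symm

theorem besselSymmPart_zero_sq (β : ℂ) {x y : ℝ} (hy : 0 < y) (hyx : y < x) :
    besselSymmPart 0 β (y ^ 2) (x ^ 2) = (Complex.Gamma β * Complex.Gamma β)⁻¹ *
      (2 : ℂ) ^ (1 - 2 * β) *
        (2 * ∫ r in Ioo y x, (((x - y) ^ 2 - (r - y * x / r) ^ 2 : ℝ) : ℂ) ^ (β - 1)) := by
  have hsq : y ^ 2 < x ^ 2 := pow_lt_pow_left₀ hyx hy.le two_ne_zero
  rw [besselSymmPart, uIoo_of_lt hsq, ← integral_Ioo_comp_sq hy.le hyx.le, ← integral_const_mul 2]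
  congr 1
  refine setIntegral_congr_fun measurableSet_Ioo fun r hr => ?_
  have hr0 : 0 < r := hy.trans hr.1
  have hry : 0 < r ^ 2 - y ^ 2 := sub_pos.2 (pow_lt_pow_left₀ hr.1 hy.le two_ne_zero)
  have hrx : 0 < x ^ 2 - r ^ 2 := sub_pos.2 (pow_lt_pow_left₀ hr.2 hr0.le two_ne_zero)
  have hbase : (x - y) ^ 2 - (r - y * x / r) ^ 2 = (r ^ 2 - y ^ 2) * (x ^ 2 - r ^ 2) / r ^ 2 := by
    field_simp
    ring
  have hexp : ((r : ℝ) : ℂ) = Complex.exp (Real.log r) := by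
    rw [← Complex.ofReal_exp, Real.exp_log hr0]
  rw [abs_sub_comm (y ^ 2), abs_sub_comm _ (x ^ 2), abs_of_pos hry, abs_of_pos hrx, hbase,
    ofReal_cpow_eq_exp hry, ofReal_cpow_eq_exp hrx, ofReal_cpow_eq_exp (pow_pos hr0 2),
    ofReal_cpow_eq_exp (by positivity), Real.log_div (by positivity) (by positivity),
    Real.log_mul hry.ne' hrx.ne', Real.log_pow, Complex.ofReal_mul, hexp, mul_assoc,
    Complex.ofReal_ofNat]
  simp only [← Complex.exp_add]
  congr 2
  push_cast
  ring

theorem besselFracKernel_zero (hβ : 0 < β.re) {x y : ℝ} (hy : 0 < y) (hyx : y < x) :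
    besselFracKernel 0 β y x = ((x - y : ℝ) : ℂ) ^ (2 * β - 1) / Complex.Gamma (2 * β) := by
  have hΓ := Complex.Gamma_ne_zero_of_re_pos hβ
  have hd : 0 < x - y := sub_pos.2 hyx
  have htwo : (2 : ℂ) ^ (1 - 2 * β) * (2 : ℂ) ^ (2 * β - 1) = 1 := by
    rw [← Complex.cpow_add _ _ two_ne_zero, sub_add_sub_cancel', sub_self, Complex.cpow_zero]
  rw [besselFracKernel_eq_symmPart 0 hβ hy (hy.trans hyx) hyx.ne, besselSymmPart_zero_sq β hy hyx,
    integral_Ioo_comp_sub_mul_div hy hyx.le (integrableOn_sq_sub_sq_cpow hβ hd)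
      fun u => by rw [neg_sq],
    integral_sq_sub_sq_cpow hβ hd, Real.rpow_zero, Complex.ofReal_one, one_mul, Complex.ofReal_mul,
    Complex.mul_cpow_ofReal_nonneg two_pos.le hd.le, Complex.ofReal_ofNat]
  calc _ = (2 : ℂ) ^ (1 - 2 * β) * (2 : ℂ) ^ (2 * β - 1) *
        (((x - y : ℝ) : ℂ) ^ (2 * β - 1) / Complex.Gamma (2 * β)) := by
        field_simp
    _ = _ := by rw [htwo, one_mul]

end

section

variable {ν a : ℝ} {β : ℂ} {p q t : ℝ}

/-- The real base of the power `z(t)` in the resolvent kernel. -/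
noncomputable def resolventBase (p q t : ℝ) : ℝ :=
  t * (1 - t) * besselGap p q ^ 2 / (1 - (1 - p ^ 2 / q ^ 2) * t)

/-- The weight `t^((3 - ν)/2) (1 - t)^((1 + ν)/2)` in the resolvent kernel. -/
noncomputable def resolventWeight (ν t : ℝ) : ℝ := t ^ ((3 - ν) / 2) * (1 - t) ^ ((1 + ν) / 2)

/-- The integrand of the Euler integral of the kernel of order `β`, written with the base and the
weight of the resolvent kernel: the power series of the resolvent kernel runs over `β = αk`. -/
noncomputable def besselEulerIntegrand (ν : ℝ) (β : ℂ) (p q t : ℝ) : ℂ :=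
  (resolventBase p q t : ℂ) ^ β / (resolventWeight ν t : ℂ)

theorem besselResolventArg_eq (α : ℂ) (p q t : ℝ) :
    besselResolventArg α p q t = (resolventBase p q t : ℂ) ^ α := by
  rw [besselResolventArg, resolventBase, besselGap, div_pow, sq_abs, mul_pow, mul_div_assoc',
    div_div, mul_comm (2 ^ 2 * q ^ 2)]
  norm_num

theorem resolventBase_pos (hp : 0 < p) (hq : 0 < q) (hpq : p ≠ q) (ht : t ∈ Ioo (0 : ℝ) 1) :
    0 < resolventBase p q t :=
  div_pos (mul_pos (mul_pos ht.1 (sub_pos.2 ht.2)) (pow_pos (besselGap_pos hp hq hpq) 2))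
    (one_sub_mul_pos p q ht)

theorem resolventBase_le (p q : ℝ) (ht : t ∈ Ioo (0 : ℝ) 1) :
    resolventBase p q t ≤ t * besselGap p q ^ 2 := by
  rw [resolventBase, div_le_iff₀ (one_sub_mul_pos p q ht), mul_right_comm]
  exact mul_le_mul_of_nonneg_left (one_sub_le_one_sub_mul p q ht.1)
    (mul_nonneg ht.1.le (sq_nonneg _))

theorem resolventWeight_pos (ν : ℝ) (ht : t ∈ Ioo (0 : ℝ) 1) : 0 < resolventWeight ν t :=
  mul_pos (Real.rpow_pos_of_pos ht.1 _) (Real.rpow_pos_of_pos (sub_pos.2 ht.2) _)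

theorem integrableOn_rpow_div_resolventWeight (hν : ν < 1) (ha : (1 - ν) / 2 < a) :
    IntegrableOn (fun t => t ^ a / resolventWeight ν t) (Ioo 0 1) := by
  refine IntegrableOn.congr_fun (integrableOn_beta (a := ((a - (1 - ν) / 2 : ℝ) : ℂ))
    (b := (((1 - ν) / 2 : ℝ) : ℂ)) (by rw [Complex.ofReal_re]; linarith)
    (by rw [Complex.ofReal_re]; linarith)).norm (fun t ht => ?_) measurableSet_Ioo
  have h1 : 0 < 1 - t := sub_pos.2 ht.2
  rw [norm_mul, Complex.norm_cpow_eq_rpow_re_of_pos ht.1, Complex.norm_cpow_eq_rpow_re_of_pos h1,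
    resolventWeight, Complex.sub_re, Complex.sub_re, Complex.ofReal_re, Complex.ofReal_re,
    Complex.one_re, div_mul_eq_div_div, ← Real.rpow_sub ht.1, div_eq_mul_inv (t ^ _),
    ← Real.rpow_neg h1.le]
  ring_nf

theorem norm_besselEulerIntegrand_le (ν : ℝ) (ha : 0 < a) (haβ : a ≤ β.re) (hp : 0 < p)
    (hq : 0 < q) (hpq : p ≠ q) (ht : t ∈ Ioo (0 : ℝ) 1) :
    ‖besselEulerIntegrand ν β p q t‖ ≤
      besselGap p q ^ (2 * β.re) * (t ^ a / resolventWeight ν t) := by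
  have hbase := resolventBase_pos hp hq hpq ht
  have hw := resolventWeight_pos ν ht
  have hgap := besselGap_pos hp hq hpq
  rw [besselEulerIntegrand, norm_div, Complex.norm_cpow_eq_rpow_re_of_pos hbase,
    Complex.norm_real, Real.norm_of_nonneg hw.le, ← mul_div_assoc]
  refine div_le_div_of_nonneg_right ?_ hw.le
  calc resolventBase p q t ^ β.re ≤ (t * besselGap p q ^ 2) ^ β.re :=
        Real.rpow_le_rpow hbase.le (resolventBase_le p q ht) (ha.le.trans haβ)
    _ = besselGap p q ^ (2 * β.re) * t ^ β.re := by
        rw [Real.mul_rpow ht.1.le (by positivity), ← Real.rpow_natCast, ← Real.rpow_mul hgap.le,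
          mul_comm, Nat.cast_ofNat]
    _ ≤ besselGap p q ^ (2 * β.re) * t ^ a :=
        mul_le_mul_of_nonneg_left (Real.rpow_le_rpow_of_exponent_ge ht.1 ht.2.le haβ)
          (Real.rpow_nonneg hgap.le _)

theorem measurable_besselEulerIntegrand (ν : ℝ) (β : ℂ) :
    Measurable fun z : (ℝ × ℝ) × ℝ => besselEulerIntegrand ν β z.1.1 z.1.2 z.2 := by
  unfold besselEulerIntegrand resolventBase besselGap resolventWeight
  fun_prop

theorem integrableOn_besselEulerIntegrand (hν : ν < 1) (hβ : (1 - ν) / 2 < β.re) (hp : 0 < p)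
    (hq : 0 < q) (hpq : p ≠ q) : IntegrableOn (besselEulerIntegrand ν β p q) (Ioo 0 1) :=
  ((integrableOn_rpow_div_resolventWeight hν hβ).const_mul _).mono'
    ((measurable_besselEulerIntegrand ν β).comp
      (measurable_prodMk_left (x := (p, q)))).aestronglyMeasurable
    ((ae_restrict_iff' measurableSet_Ioo).2 (Eventually.of_forall fun _ ht =>
      norm_besselEulerIntegrand_le ν (re_pos_of_half_lt hν hβ) le_rfl hp hq hpq ht))

theorem besselEulerIntegrand_eq (ν : ℝ) (β : ℂ) (hp : 0 < p) (hq : 0 < q) (hpq : p ≠ q)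
    (ht : t ∈ Ioo (0 : ℝ) 1) :
    besselEulerIntegrand ν β p q t = (besselGap p q : ℂ) ^ (2 * β) *
      ((t : ℂ) ^ (β + ((ν : ℂ) - 1) / 2 - 1) *
        ((1 - t : ℝ) : ℂ) ^ (2 * β - (β + ((ν : ℂ) - 1) / 2) - 1) *
        ((1 - (1 - p ^ 2 / q ^ 2) * t : ℝ) : ℂ) ^ (-β)) := by
  have h0 := ht.1
  have h1 : 0 < 1 - t := sub_pos.2 ht.2
  have hgap := besselGap_pos hp hq hpq
  have hbase := resolventBase_pos hp hq hpq ht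
  have hden := one_sub_mul_pos p q ht
  rw [besselEulerIntegrand, resolventWeight, Complex.ofReal_mul, Complex.ofReal_cpow h0.le,
    Complex.ofReal_cpow h1.le, ofReal_cpow_eq_exp hbase, ofReal_cpow_eq_exp hgap,
    ofReal_cpow_eq_exp h0, ofReal_cpow_eq_exp h1, ofReal_cpow_eq_exp hden, ofReal_cpow_eq_exp h0,
    ofReal_cpow_eq_exp h1, resolventBase, Real.log_div (by positivity) hden.ne',
    Real.log_mul (by positivity) (by positivity), Real.log_mul h0.ne' h1.ne', Real.log_pow]
  simp only [← Complex.exp_add, ← Complex.exp_sub]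
  congr 1
  push_cast
  ring

theorem besselFracKernel_eq_integral (hν : ν < 1) (hβ : (1 - ν) / 2 < β.re) (hp : 0 < p)
    (hq : 0 < q) (hpq : p ≠ q) :
    besselFracKernel ν β p q = besselCoeff ν β * (besselGap p q : ℂ)⁻¹ *
      ∫ t in Ioo (0 : ℝ) 1, besselEulerIntegrand ν β p q t := by
  have hΓ : Complex.Gamma (2 * β) ≠ 0 :=
    Complex.Gamma_ne_zero_of_re_pos (by simpa using re_pos_of_half_lt hν hβ)
  have hsub : 2 * β - (β + ((ν : ℂ) - 1) / 2) = β - ((ν : ℂ) - 1) / 2 := by ring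
  have hgap : (besselGap p q : ℂ) ≠ 0 := by exact_mod_cast (besselGap_pos hp hq hpq).ne'
  rw [setIntegral_congr_fun measurableSet_Ioo fun t ht =>
      besselEulerIntegrand_eq ν β hp hq hpq ht, integral_const_mul, ← eulerIntegral,
    besselFracKernel, gaussHyp_eq_eulerIntegral_swap _ (re_add_half_pos hβ)
      (by rw [hsub]; exact re_sub_half_pos hν hβ) (one_sub_sq_div_sq_lt_one hp hq), hsub,
    ← besselGap, Complex.cpow_sub _ _ hgap, Complex.cpow_one, besselCoeff]
  field_simp

theorem norm_besselFracKernel_le (hν : ν < 1) (ha : (1 - ν) / 2 < a) (haβ : a ≤ β.re)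
    (hp : 0 < p) (hq : 0 < q) (hpq : p ≠ q) :
    ‖besselFracKernel ν β p q‖ ≤ ‖besselCoeff ν β‖ * besselGap p q ^ (2 * β.re - 1) *
      ∫ t in Ioo (0 : ℝ) 1, t ^ a / resolventWeight ν t := by
  have hgap := besselGap_pos hp hq hpq
  have ha0 : 0 < a := by linarith
  rw [besselFracKernel_eq_integral hν (ha.trans_le haβ) hp hq hpq, norm_mul, norm_mul, norm_inv,
    Complex.norm_real, Real.norm_of_nonneg hgap.le, Real.rpow_sub_one hgap.ne', div_eq_inv_mul,
    ← mul_assoc, mul_assoc _ (besselGap p q ^ _), ← integral_const_mul]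
  refine mul_le_mul_of_nonneg_left ?_ (by positivity)
  exact norm_integral_le_of_norm_le ((integrableOn_rpow_div_resolventWeight hν ha).const_mul _)
    ((ae_restrict_iff' measurableSet_Ioo).2 (Eventually.of_forall fun _ ht =>
      norm_besselEulerIntegrand_le ν ha0 haβ hp hq hpq ht))

end

/-! ### The Neumann series of kernels -/

theorem aestronglyMeasurable_of_hasSum {X : Type*} [MeasurableSpace X] {μ : Measure X}
    {F : ℕ → X → ℂ} {f : X → ℂ} (hF : ∀ n, AEStronglyMeasurable (F n) μ)
    (h : ∀ᵐ x ∂μ, HasSum (fun n => F n x) (f x)) : AEStronglyMeasurable f μ :=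
  aestronglyMeasurable_of_tendsto_ae atTop
    (fun n => Finset.aestronglyMeasurable_fun_sum (Finset.range n) fun i _ => hF i)
    (h.mono fun _ hx => hx.tendsto_sum_nat)

section

variable {ν : ℝ} {α : ℂ} {p q t : ℝ}

theorem summable_norm_besselCoeff_mul_pow (hν : ν < 1) (hα : (1 - ν) / 2 < α.re) {r : ℝ}
    (hr : 0 ≤ r) : Summable fun k : ℕ => ‖besselCoeff ν (α * (k + 1 : ℕ))‖ * r ^ (k + 1) := by
  refine (besselWrightTerm_summable hν hα r).norm.congr fun k => ?_
  rw [besselWrightTerm_eq, norm_mul, norm_pow, Complex.norm_real, Real.norm_of_nonneg hr]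

/-- The `k`-th term of the expansion of the integrand of the resolvent kernel that comes from the
power series `S_{α,ν}`. -/
noncomputable def resolventIntegrandTerm (ν : ℝ) (α lam : ℂ) (p q : ℝ) (k : ℕ) (t : ℝ) : ℂ :=
  (lam ^ (k + 1))⁻¹ * besselCoeff ν (α * (k + 1 : ℕ)) *
    besselEulerIntegrand ν (α * (k + 1 : ℕ)) p q t

/-- The `k`-th term of the Neumann series of the resolvent kernel. -/
noncomputable def neumannTerm (ν : ℝ) (α lam : ℂ) (k : ℕ) (p q : ℝ) : ℂ :=
  (lam ^ (k + 1))⁻¹ * besselFracKernel ν (α * (k + 1 : ℕ)) p q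

theorem hasSum_resolventIntegrandTerm (hν : ν < 1) (hα : (1 - ν) / 2 < α.re) (lam : ℂ)
    (p q t : ℝ) :
    HasSum (fun k => resolventIntegrandTerm ν α lam p q k t)
      (besselResolventIntegrand ν α lam p q t) := by
  have h := (besselWrightTerm_summable hν hα (besselResolventArg α p q t / lam)).hasSum.div_const
    (resolventWeight ν t : ℂ)
  refine h.congr_fun fun k => ?_
  rw [resolventIntegrandTerm, besselWrightTerm_eq, besselResolventArg_eq, besselEulerIntegrand,
    div_pow, ← Complex.cpow_mul_nat]
  ring

theorem norm_resolventIntegrandTerm_le (hν : ν < 1) (hα : (1 - ν) / 2 < α.re) (lam : ℂ)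
    (hp : 0 < p) (hq : 0 < q) (hpq : p ≠ q) (ht : t ∈ Ioo (0 : ℝ) 1) (k : ℕ) :
    ‖resolventIntegrandTerm ν α lam p q k t‖ ≤ ‖besselCoeff ν (α * (k + 1 : ℕ))‖ *
      (besselGap p q ^ (2 * α.re) / ‖lam‖) ^ (k + 1) * (t ^ α.re / resolventWeight ν t) := by
  have h0 := re_pos_of_half_lt hν hα
  have h := norm_besselEulerIntegrand_le ν h0 (re_le_mul_succ_re h0.le k) hp hq hpq ht
  rw [mul_natCast_re, ← mul_assoc, Real.rpow_mul (besselGap_pos hp hq hpq).le,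
    Real.rpow_natCast] at h
  rw [resolventIntegrandTerm, norm_mul, norm_mul, norm_inv, norm_pow, div_pow]
  calc _ ≤ (‖lam‖ ^ (k + 1))⁻¹ * ‖besselCoeff ν (α * (k + 1 : ℕ))‖ * _ :=
        mul_le_mul_of_nonneg_left h (by positivity)
    _ = _ := by ring

theorem integrableOn_resolventIntegrandTerm (hν : ν < 1) (hα : (1 - ν) / 2 < α.re) (lam : ℂ)
    (hp : 0 < p) (hq : 0 < q) (hpq : p ≠ q) (k : ℕ) :
    IntegrableOn (resolventIntegrandTerm ν α lam p q k) (Ioo 0 1) :=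
  (integrableOn_besselEulerIntegrand hν
    (hα.trans_le (re_le_mul_succ_re (re_pos_of_half_lt hν hα).le k)) hp hq hpq).const_mul _

theorem integrableOn_besselResolventIntegrand (hν : ν < 1) (hα : (1 - ν) / 2 < α.re) (lam : ℂ)
    (hp : 0 < p) (hq : 0 < q) (hpq : p ≠ q) :
    IntegrableOn (besselResolventIntegrand ν α lam p q) (Ioo 0 1) := by
  have hr : 0 ≤ besselGap p q ^ (2 * α.re) / ‖lam‖ :=
    div_nonneg (Real.rpow_nonneg (besselGap_pos hp hq hpq).le _) (norm_nonneg _)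
  refine ((integrableOn_rpow_div_resolventWeight hν hα).const_mul
    (∑' k : ℕ, ‖besselCoeff ν (α * (k + 1 : ℕ))‖ *
      (besselGap p q ^ (2 * α.re) / ‖lam‖) ^ (k + 1))).mono'
    (aestronglyMeasurable_of_hasSum
      (fun k => (integrableOn_resolventIntegrandTerm hν hα lam hp hq hpq k).aestronglyMeasurable)
      (Eventually.of_forall (hasSum_resolventIntegrandTerm hν hα lam p q)))
    ((ae_restrict_iff' measurableSet_Ioo).2 (Eventually.of_forall fun t ht => ?_))
  rw [← (hasSum_resolventIntegrandTerm hν hα lam p q t).tsum_eq, ← tsum_mul_right]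
  exact tsum_of_norm_bounded
    ((summable_norm_besselCoeff_mul_pow hν hα hr).mul_right _).hasSum
    fun k => norm_resolventIntegrandTerm_le hν hα lam hp hq hpq ht k

theorem summable_integral_norm_resolventIntegrandTerm (hν : ν < 1) (hα : (1 - ν) / 2 < α.re)
    (lam : ℂ) (hp : 0 < p) (hq : 0 < q) (hpq : p ≠ q) :
    Summable fun k => ∫ t in Ioo (0 : ℝ) 1, ‖resolventIntegrandTerm ν α lam p q k t‖ := by
  have hr : 0 ≤ besselGap p q ^ (2 * α.re) / ‖lam‖ :=
    div_nonneg (Real.rpow_nonneg (besselGap_pos hp hq hpq).le _) (norm_nonneg _)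
  refine Summable.of_nonneg_of_le (fun k => integral_nonneg fun t => norm_nonneg _) (fun k => ?_)
    ((summable_norm_besselCoeff_mul_pow hν hα hr).mul_right
      (∫ t in Ioo (0 : ℝ) 1, t ^ α.re / resolventWeight ν t))
  rw [← integral_const_mul]
  exact setIntegral_mono_on (integrableOn_resolventIntegrandTerm hν hα lam hp hq hpq k).norm
    ((integrableOn_rpow_div_resolventWeight hν hα).const_mul _) measurableSet_Ioo
    fun t ht => norm_resolventIntegrandTerm_le hν hα lam hp hq hpq ht k

theorem hasSum_neumannTerm (hν : ν < 1) (hα : (1 - ν) / 2 < α.re) (lam : ℂ) (hp : 0 < p)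
    (hq : 0 < q) (hpq : p ≠ q) :
    HasSum (fun k => neumannTerm ν α lam k p q) (besselResolventKernel ν α lam p q) := by
  have h := (hasSum_integral_of_summable_integral_norm
    (integrableOn_resolventIntegrandTerm hν hα lam hp hq hpq)
    (summable_integral_norm_resolventIntegrandTerm hν hα lam hp hq hpq)).mul_left
      ((2 * q / |p ^ 2 - q ^ 2| : ℝ) : ℂ)
  simp_rw [(hasSum_resolventIntegrandTerm hν hα lam p q _).tsum_eq] at h
  refine h.congr_fun fun k => ?_
  rw [neumannTerm, besselFracKernel_eq_integral hν
    (hα.trans_le (re_le_mul_succ_re (re_pos_of_half_lt hν hα).le k)) hp hq hpq, ← inv_div,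
    Complex.ofReal_inv, ← besselGap]
  simp only [resolventIntegrandTerm, integral_const_mul]
  ring

theorem besselResolventKernel_symm (hν : ν < 1) (hα : (1 - ν) / 2 < α.re) (lam : ℂ) (hp : 0 < p)
    (hq : 0 < q) (hpq : p ≠ q) :
    besselResolventKernel ν α lam p q * ((p ^ ν : ℝ) : ℂ) =
      besselResolventKernel ν α lam q p * ((q ^ ν : ℝ) : ℂ) := by
  have h0 := re_pos_of_half_lt hν hα
  refine ((hasSum_neumannTerm hν hα lam hp hq hpq).mul_right _).unique
    (((hasSum_neumannTerm hν hα lam hq hp hpq.symm).mul_right _).congr_fun fun k => ?_)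
  rw [neumannTerm, neumannTerm, mul_assoc, mul_assoc,
    besselFracKernel_symm ν (h0.trans_le (re_le_mul_succ_re h0.le k)) hp hq hpq]

theorem besselResolventKernel_zero (hα : 1 / 2 < α.re) (lam : ℂ) {x y : ℝ} (hy : 0 < y)
    (hyx : y < x) :
    besselResolventKernel 0 α lam y x = (1 / lam) * ((x - y : ℝ) : ℂ) ^ (2 * α - 1) *
      mittagLeffler (2 * α) (2 * α) (((x - y : ℝ) : ℂ) ^ (2 * α) / lam) := by
  have h0 : 0 < α.re := by linarith
  have hd : ((x - y : ℝ) : ℂ) ≠ 0 := by exact_mod_cast (sub_pos.2 hyx).ne'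
  rw [← (hasSum_neumannTerm one_pos (by rwa [sub_zero]) lam hy (hy.trans hyx) hyx.ne).tsum_eq,
    mittagLeffler, ← tsum_mul_left]
  refine tsum_congr fun n => ?_
  rw [neumannTerm, besselFracKernel_zero (h0.trans_le (re_le_mul_succ_re h0.le n)) hy hyx, div_pow,
    ← Complex.cpow_mul_nat, show 2 * α * n + 2 * α = 2 * (α * (n + 1 : ℕ)) by push_cast; ring,
    show 2 * (α * (n + 1 : ℕ)) - 1 = 2 * α - 1 + 2 * α * n by push_cast; ring,
    Complex.cpow_add _ _ hd, pow_succ]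
  ring

end

section

variable {ν a b : ℝ} {β : ℂ} {x y : ℝ}

theorem besselGap_le_sub (hy : 0 < y) (hyx : y < x) : besselGap y x ≤ x - y := by
  rw [besselGap, abs_of_neg (by nlinarith), div_le_iff₀ (by linarith)]
  nlinarith

theorem half_sub_le_besselGap (hy : 0 < y) (hyx : y < x) : (x - y) / 2 ≤ besselGap y x := by
  rw [besselGap, abs_of_neg (by nlinarith), le_div_iff₀ (by linarith)]
  nlinarith

theorem besselGap_rpow_le {e : ℝ} (he : -1 ≤ e) (hy : 0 < y) (hyx : y < x) :
    besselGap y x ^ e ≤ 2 * (x - y) ^ e := by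
  have hd : 0 < x - y := sub_pos.2 hyx
  have hpow : 0 ≤ (x - y) ^ e := Real.rpow_nonneg hd.le _
  rcases le_or_gt 0 e with h | h
  · exact (Real.rpow_le_rpow (besselGap_pos hy (hy.trans hyx) hyx.ne).le
      (besselGap_le_sub hy hyx) h).trans (by linarith)
  · calc besselGap y x ^ e ≤ ((x - y) / 2) ^ e :=
          Real.rpow_le_rpow_of_nonpos (half_pos hd) (half_sub_le_besselGap hy hyx) h.le
      _ = 2 ^ (-e) * (x - y) ^ e := by
          rw [Real.div_rpow hd.le two_pos.le, div_eq_inv_mul, Real.rpow_neg two_pos.le]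
      _ ≤ 2 ^ (1 : ℝ) * (x - y) ^ e := mul_le_mul_of_nonneg_right
          (Real.rpow_le_rpow_of_exponent_le one_le_two (by linarith)) hpow
      _ = 2 * (x - y) ^ e := by rw [Real.rpow_one]

theorem norm_besselFracKernel_le_of_lt (hν : ν < 1) (ha : (1 - ν) / 2 < a) (haβ : a ≤ β.re)
    (hy : 0 < y) (hyx : y < x) (hxb : x < b) :
    ‖besselFracKernel ν β y x‖ ≤ ‖besselCoeff ν β‖ * (b ^ (2 * (β.re - a)) *
      (2 * ∫ t in Ioo (0 : ℝ) 1, t ^ a / resolventWeight ν t)) * (x - y) ^ (2 * a - 1) := by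
  have hx := hy.trans hyx
  have hgap := besselGap_pos hy hx hyx.ne
  have hI : 0 ≤ ∫ t in Ioo (0 : ℝ) 1, t ^ a / resolventWeight ν t :=
    setIntegral_nonneg measurableSet_Ioo fun t ht =>
      div_nonneg (Real.rpow_nonneg ht.1.le _) (resolventWeight_pos ν ht).le
  calc _ ≤ _ := norm_besselFracKernel_le hν ha haβ hy hx hyx.ne
    _ = ‖besselCoeff ν β‖ * (besselGap y x ^ (2 * (β.re - a)) * besselGap y x ^ (2 * a - 1)) *
        ∫ t in Ioo (0 : ℝ) 1, t ^ a / resolventWeight ν t := by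
        rw [← Real.rpow_add hgap]
        ring_nf
    _ ≤ ‖besselCoeff ν β‖ * (b ^ (2 * (β.re - a)) * (2 * (x - y) ^ (2 * a - 1))) *
        ∫ t in Ioo (0 : ℝ) 1, t ^ a / resolventWeight ν t := by
        gcongr
        · exact Real.rpow_nonneg (by linarith) _
        · exact (besselGap_le_sub hy hyx).trans (by linarith)
        · exact besselGap_rpow_le (by linarith) hy hyx
    _ = _ := by ring

theorem measurable_integral_besselEulerIntegrand (ν : ℝ) (β : ℂ) :
    Measurable fun z : ℝ × ℝ => ∫ t in Ioo (0 : ℝ) 1, besselEulerIntegrand ν β z.1 z.2 t :=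
  (StronglyMeasurable.integral_prod_right'
    (measurable_besselEulerIntegrand ν β).stronglyMeasurable).measurable

end

/-! ### Fubini's theorem on a triangle -/

/-- The triangle `0 < y < x < b`, on which the kernels of Volterra operators on `(0, b)` live. -/
def triangle (b : ℝ) : Set (ℝ × ℝ) := {z | 0 < z.2 ∧ z.2 < z.1 ∧ z.1 < b}

theorem measurableSet_triangle (b : ℝ) : MeasurableSet (triangle b) :=
  (measurableSet_lt measurable_const measurable_snd).inter
    ((measurableSet_lt measurable_snd measurable_fst).inter
      (measurableSet_lt measurable_fst measurable_const))

section

variable {E : Type*} [NormedAddCommGroup E] {b : ℝ} {F : ℝ × ℝ → E}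

theorem indicator_triangle_left (b : ℝ) (F : ℝ × ℝ → E) (x y : ℝ) :
    (triangle b).indicator F (x, y) =
      (Ioo 0 b).indicator (fun x => (Ioo 0 x).indicator (fun y => F (x, y)) y) x := by
  simp only [indicator, triangle, mem_ofPred_eq, mem_Ioo]
  grind

theorem indicator_triangle_right (b : ℝ) (F : ℝ × ℝ → E) (x y : ℝ) :
    (triangle b).indicator F (x, y) =
      (Ioo 0 b).indicator (fun y => (Ioo y b).indicator (fun x => F (x, y)) x) y := by
  simp only [indicator, triangle, mem_ofPred_eq, mem_Ioo]
  grind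

theorem integrableOn_triangle_of_forall (hF : AEStronglyMeasurable F (volume.restrict (triangle b)))
    (hslice : ∀ x ∈ Ioo 0 b, IntegrableOn (fun y => F (x, y)) (Ioo 0 x))
    (hnorm : IntegrableOn (fun x => ∫ y in Ioo 0 x, ‖F (x, y)‖) (Ioo 0 b)) :
    IntegrableOn F (triangle b) := by
  rw [← integrable_indicator_iff (measurableSet_triangle b), Measure.volume_eq_prod,
    integrable_prod_iff ((aestronglyMeasurable_indicator_iff (measurableSet_triangle b)).2 hF)]
  rw [← integrable_indicator_iff measurableSet_Ioo] at hnorm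
  simp only [indicator_triangle_left, norm_indicator_eq_indicator_norm]
  refine ⟨Eventually.of_forall fun x => ?_, hnorm.congr (Eventually.of_forall fun x => ?_)⟩ <;>
    by_cases hx : x ∈ Ioo 0 b
  · simpa only [indicator_of_mem hx, integrable_indicator_iff measurableSet_Ioo] using hslice x hx
  · simp only [indicator_of_notMem hx]
    exact integrable_zero _ _ _
  · simp only [indicator_of_mem hx, integral_indicator measurableSet_Ioo]
  · simp only [indicator_of_notMem hx, integral_zero]

theorem ae_integrableOn_of_integrableOn_triangle (hF : IntegrableOn F (triangle b)) :
    ∀ᵐ x ∂volume.restrict (Ioo 0 b), IntegrableOn (fun y => F (x, y)) (Ioo 0 x) := by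
  rw [← integrable_indicator_iff (measurableSet_triangle b)] at hF
  rw [ae_restrict_iff' measurableSet_Ioo]
  filter_upwards [hF.prod_right_ae] with x hslice hx
  simpa only [indicator_triangle_left, indicator_of_mem hx,
    integrable_indicator_iff measurableSet_Ioo] using hslice

variable [NormedSpace ℝ E]

theorem integral_indicator_triangle_left (b : ℝ) (F : ℝ × ℝ → E) (x : ℝ) :
    ∫ y, (triangle b).indicator F (x, y) =
      (Ioo 0 b).indicator (fun x => ∫ y in Ioo 0 x, F (x, y)) x := by
  simp only [indicator_triangle_left]
  by_cases hx : x ∈ Ioo 0 b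
  · simp only [indicator_of_mem hx, integral_indicator measurableSet_Ioo]
  · simp only [indicator_of_notMem hx, integral_zero]

theorem integral_indicator_triangle_right (b : ℝ) (F : ℝ × ℝ → E) (y : ℝ) :
    ∫ x, (triangle b).indicator F (x, y) =
      (Ioo 0 b).indicator (fun y => ∫ x in Ioo y b, F (x, y)) y := by
  simp only [indicator_triangle_right]
  by_cases hy : y ∈ Ioo 0 b
  · simp only [indicator_of_mem hy, integral_indicator measurableSet_Ioo]
  · simp only [indicator_of_notMem hy, integral_zero]

theorem integrableOn_integral_of_integrableOn_triangle (hF : IntegrableOn F (triangle b)) :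
    IntegrableOn (fun x => ∫ y in Ioo 0 x, F (x, y)) (Ioo 0 b) := by
  rw [← integrable_indicator_iff (measurableSet_triangle b)] at hF
  rw [← integrable_indicator_iff measurableSet_Ioo]
  exact hF.integral_prod_left.congr
    (Eventually.of_forall (integral_indicator_triangle_left b F))

theorem setIntegral_triangle (hF : IntegrableOn F (triangle b)) :
    ∫ z in triangle b, F z = ∫ x in Ioo 0 b, ∫ y in Ioo 0 x, F (x, y) := by
  rw [← integrable_indicator_iff (measurableSet_triangle b)] at hF
  rw [← integral_indicator (measurableSet_triangle b), Measure.volume_eq_prod, integral_prod _ hF]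
  simp only [integral_indicator_triangle_left, integral_indicator measurableSet_Ioo]

theorem integral_integral_swap_triangle (hF : IntegrableOn F (triangle b)) :
    ∫ x in Ioo 0 b, ∫ y in Ioo 0 x, F (x, y) = ∫ y in Ioo 0 b, ∫ x in Ioo y b, F (x, y) := by
  rw [← integrable_indicator_iff (measurableSet_triangle b)] at hF
  have h := integral_integral_swap (f := fun x y => (triangle b).indicator F (x, y)) hF
  simpa only [integral_indicator_triangle_left, integral_indicator_triangle_right,
    integral_indicator measurableSet_Ioo] using h

end

/-! ### Moments of the kernels -/

theorem integral_norm_beta_scaled {u v : ℂ} (hu : 0 < u.re) (hv : 0 < v.re) {S : ℝ}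
    (hS : 0 < S) :
    ∫ y in Ioo 0 S, ‖(y : ℂ) ^ (u - 1) * ((S - y : ℝ) : ℂ) ^ (v - 1)‖ =
      S ^ (u.re + v.re - 1) *
        (Real.Gamma u.re * Real.Gamma v.re / Real.Gamma (u.re + v.re)) := by
  have h := integral_beta_scaled (u := (u.re : ℂ)) (v := (v.re : ℂ)) hu hv hS
  rw [← Complex.ofReal_add, Complex.Gamma_ofReal, Complex.Gamma_ofReal, Complex.Gamma_ofReal,
    ← Complex.ofReal_one, ← Complex.ofReal_sub, ← Complex.ofReal_sub, ← Complex.ofReal_sub,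
    ← Complex.ofReal_cpow hS.le] at h
  have hnorm : ∀ y ∈ Ioo 0 S, (y : ℂ) ^ ((u.re - 1 : ℝ) : ℂ) *
      ((S - y : ℝ) : ℂ) ^ ((v.re - 1 : ℝ) : ℂ) =
        (‖(y : ℂ) ^ (u - 1) * ((S - y : ℝ) : ℂ) ^ (v - 1)‖ : ℝ) := fun y hy => by
    have hSy : 0 < S - y := sub_pos.2 hy.2
    rw [norm_mul, Complex.norm_cpow_eq_rpow_re_of_pos hy.1,
      Complex.norm_cpow_eq_rpow_re_of_pos hSy, Complex.ofReal_mul, Complex.ofReal_cpow hy.1.le,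
      Complex.ofReal_cpow hSy.le, Complex.sub_re, Complex.sub_re, Complex.one_re]
  rw [setIntegral_congr_fun measurableSet_Ioo hnorm, integral_complex_ofReal] at h
  exact_mod_cast h

section

variable {τ β κ : ℂ} {b : ℝ}

theorem integrableOn_triangle_beta (hτ : 0 < τ.re) (hβ : 0 < β.re) (hκ : 0 < (τ + β + κ).re)
    (hb : 0 < b) :
    IntegrableOn (fun z : ℝ × ℝ => ((b - z.1 : ℝ) : ℂ) ^ (β - 1) * (z.1 : ℂ) ^ κ *
      ((z.2 : ℂ) ^ (τ - 1) * ((z.1 - z.2 : ℝ) : ℂ) ^ (β - 1))) (triangle b) := by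
  have hmeas : Measurable fun z : ℝ × ℝ => ((b - z.1 : ℝ) : ℂ) ^ (β - 1) * (z.1 : ℂ) ^ κ *
      ((z.2 : ℂ) ^ (τ - 1) * ((z.1 - z.2 : ℝ) : ℂ) ^ (β - 1)) := by fun_prop
  refine integrableOn_triangle_of_forall hmeas.aestronglyMeasurable
    (fun x hx => (integrableOn_beta_scaled hτ hβ hx.1).const_mul
      (((b - x : ℝ) : ℂ) ^ (β - 1) * (x : ℂ) ^ κ)) ?_
  refine IntegrableOn.congr_fun ((integrableOn_beta_scaled hκ hβ hb).norm.mul_const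
    (Real.Gamma τ.re * Real.Gamma β.re / Real.Gamma (τ.re + β.re))) (fun x hx => ?_)
    measurableSet_Ioo
  have hpow : ‖(x : ℂ) ^ (τ + β + κ - 1)‖ = ‖(x : ℂ) ^ κ‖ * x ^ (τ.re + β.re - 1) := by
    rw [show τ + β + κ - 1 = κ + (τ + β - 1) by ring, ofReal_cpow_add hx.1, norm_mul,
      Complex.norm_cpow_eq_rpow_re_of_pos hx.1 (τ + β - 1), Complex.sub_re, Complex.add_re,
      Complex.one_re]
  simp only [norm_mul _ ((_ : ℂ) * _)]
  rw [integral_const_mul, integral_norm_beta_scaled hτ hβ hx.1, norm_mul, norm_mul, hpow]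
  ring

theorem integral_mul_integral_beta (hτ : 0 < τ.re) (hβ : 0 < β.re) (hκ : 0 < (τ + β + κ).re)
    (hb : 0 < b) :
    ∫ y in Ioo 0 b, (y : ℂ) ^ (τ - 1) * ∫ s in Ioo y b,
      ((b - s : ℝ) : ℂ) ^ (β - 1) * ((s - y : ℝ) : ℂ) ^ (β - 1) * (s : ℂ) ^ κ =
    (b : ℂ) ^ (τ + β + κ + β - 1) *
      (Complex.Gamma τ * Complex.Gamma β / Complex.Gamma (τ + β)) *
      (Complex.Gamma (τ + β + κ) * Complex.Gamma β / Complex.Gamma (τ + β + κ + β)) := by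
  have hinner : ∀ s ∈ Ioo 0 b, ∫ y in Ioo 0 s, ((b - s : ℝ) : ℂ) ^ (β - 1) * (s : ℂ) ^ κ *
      ((y : ℂ) ^ (τ - 1) * ((s - y : ℝ) : ℂ) ^ (β - 1)) =
        Complex.Gamma τ * Complex.Gamma β / Complex.Gamma (τ + β) *
          ((s : ℂ) ^ (τ + β + κ - 1) * ((b - s : ℝ) : ℂ) ^ (β - 1)) := fun s hs => by
    rw [integral_const_mul, integral_beta_scaled hτ hβ hs.1,
      show τ + β + κ - 1 = κ + (τ + β - 1) by ring, ofReal_cpow_add hs.1]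
    ring
  calc _ = ∫ y in Ioo 0 b, ∫ s in Ioo y b, ((b - s : ℝ) : ℂ) ^ (β - 1) * (s : ℂ) ^ κ *
        ((y : ℂ) ^ (τ - 1) * ((s - y : ℝ) : ℂ) ^ (β - 1)) := by
        simp_rw [← integral_const_mul]
        congr! 4
        ring
    _ = _ := by
        rw [← integral_integral_swap_triangle (integrableOn_triangle_beta hτ hβ hκ hb),
          setIntegral_congr_fun measurableSet_Ioo hinner, integral_const_mul,
          integral_beta_scaled hκ hβ hb]
        ring

end

theorem besselSymmPart_of_lt (ν : ℝ) (β : ℂ) {P Q : ℝ} (hPQ : P < Q) :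
    besselSymmPart ν β P Q = (Complex.Gamma β * Complex.Gamma β)⁻¹ * (2 : ℂ) ^ (1 - 2 * β) *
      ∫ s in Ioo P Q, ((Q - s : ℝ) : ℂ) ^ (β - 1) * ((s - P : ℝ) : ℂ) ^ (β - 1) *
        (s : ℂ) ^ ((1 - (ν : ℂ)) / 2 - β) := by
  rw [besselSymmPart, uIoo_of_lt hPQ]
  congr 1
  refine setIntegral_congr_fun measurableSet_Ioo fun s hs => ?_
  rw [abs_of_neg (sub_neg.2 hs.1), abs_of_neg (sub_neg.2 hs.2), neg_sub, neg_sub,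
    mul_comm (((s - P : ℝ) : ℂ) ^ _)]

/-- The factor by which Bessel fractional integration of order `β` multiplies the power `y ^ σ`,
apart from raising its exponent by `2β`. -/
noncomputable def besselMoment (ν : ℝ) (β σ : ℂ) : ℂ :=
  (2 : ℂ) ^ (-(2 * β)) *
    (Complex.Gamma ((σ + 1) / 2) * Complex.Gamma ((σ + 1) / 2 + (1 - (ν : ℂ)) / 2)) /
    (Complex.Gamma ((σ + 1) / 2 + β) * Complex.Gamma ((σ + 1) / 2 + (1 - (ν : ℂ)) / 2 + β))

section

variable {ν : ℝ} {β γ σ : ℂ}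

theorem half_add_one_re_pos (hσ : 0 ≤ σ.re) : 0 < ((σ + 1) / 2).re := by
  rw [Complex.div_ofNat_re, Complex.add_re, Complex.one_re]
  positivity

theorem half_add_one_add_half_re_pos (hν : ν < 1) (hσ : 0 ≤ σ.re) :
    0 < ((σ + 1) / 2 + (1 - (ν : ℂ)) / 2).re := by
  rw [← neg_sub (ν : ℂ) 1, neg_div, Complex.add_re, Complex.neg_re, half_sub_one_re]
  linarith [half_add_one_re_pos hσ]

theorem besselFracKernel_mul_cpow_eq (ν : ℝ) (hβ : 0 < β.re) (σ : ℂ) {x y : ℝ} (hy : 0 < y)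
    (hyx : y < x) :
    besselFracKernel ν β y x * (y : ℂ) ^ σ =
      ((x ^ ν : ℝ) : ℂ) * ((Complex.Gamma β * Complex.Gamma β)⁻¹ * (2 : ℂ) ^ (-(2 * β))) *
        (((2 * y : ℝ) : ℂ) * (((y ^ 2 : ℝ) : ℂ) ^ ((σ + 1) / 2 - 1) *
          ∫ s in Ioo (y ^ 2) (x ^ 2), ((x ^ 2 - s : ℝ) : ℂ) ^ (β - 1) *
            ((s - y ^ 2 : ℝ) : ℂ) ^ (β - 1) * (s : ℂ) ^ ((1 - (ν : ℂ)) / 2 - β))) := by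
  have hpow : (y : ℂ) ^ σ = y * ((y ^ 2 : ℝ) : ℂ) ^ ((σ + 1) / 2 - 1) := by
    nth_rw 2 [← Complex.cpow_one (y : ℂ)]
    rw [ofReal_cpow_eq_exp (pow_pos hy 2), Real.log_pow, ofReal_cpow_eq_exp hy,
      ofReal_cpow_eq_exp hy, ← Complex.exp_add]
    congr 1
    push_cast
    ring
  rw [besselFracKernel_eq_symmPart ν hβ hy (hy.trans hyx) hyx.ne, besselSymmPart_of_lt ν β
    (pow_lt_pow_left₀ hyx hy.le two_ne_zero), hpow, sub_eq_add_neg 1 (2 * β),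
    Complex.cpow_add _ _ two_ne_zero, Complex.cpow_one]
  push_cast
  ring

theorem integral_besselFracKernel_mul_cpow (hν : ν < 1) (hβ : 0 < β.re) (hσ : 0 ≤ σ.re) {x : ℝ}
    (hx : 0 < x) :
    ∫ y in Ioo 0 x, besselFracKernel ν β y x * (y : ℂ) ^ σ =
      besselMoment ν β σ * (x : ℂ) ^ (σ + 2 * β) := by
  have he : (σ + 1) / 2 + β + ((1 - (ν : ℂ)) / 2 - β) = (σ + 1) / 2 + (1 - (ν : ℂ)) / 2 := by ring
  have hbeta := integral_mul_integral_beta (half_add_one_re_pos hσ) hβ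
    (he ▸ half_add_one_add_half_re_pos hν hσ) (pow_pos hx 2)
  rw [← zero_pow two_ne_zero, ← integral_Ioo_comp_sq le_rfl hx.le, he] at hbeta
  have hpow : ((x ^ ν : ℝ) : ℂ) * ((x ^ 2 : ℝ) : ℂ) ^ ((σ + 1) / 2 + (1 - (ν : ℂ)) / 2 + β - 1) =
      (x : ℂ) ^ (σ + 2 * β) := by
    rw [Complex.ofReal_cpow hx.le, ofReal_cpow_eq_exp hx, ofReal_cpow_eq_exp (pow_pos hx 2),
      ofReal_cpow_eq_exp hx, ← Complex.exp_add, Real.log_pow]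
    congr 1
    push_cast
    ring
  have hGamma := Complex.Gamma_ne_zero_of_re_pos hβ
  rw [setIntegral_congr_fun measurableSet_Ioo
    fun y hy => besselFracKernel_mul_cpow_eq ν hβ σ hy.1 hy.2, integral_const_mul, hbeta,
    besselMoment, ← hpow]
  field_simp

theorem besselMoment_mul (hν : ν < 1) (hβ : 0 < β.re) (hσ : 0 ≤ σ.re) :
    besselMoment ν β σ * besselMoment ν γ (σ + 2 * β) = besselMoment ν (β + γ) σ := by
  have h₁ : Complex.Gamma ((σ + 1) / 2 + β) ≠ 0 :=
    Complex.Gamma_ne_zero_of_re_pos (add_pos (half_add_one_re_pos hσ) hβ)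
  have h₂ : Complex.Gamma ((σ + 1) / 2 + (1 - (ν : ℂ)) / 2 + β) ≠ 0 :=
    Complex.Gamma_ne_zero_of_re_pos (add_pos (half_add_one_add_half_re_pos hν hσ) hβ)
  rw [besselMoment, besselMoment, besselMoment,
    show (σ + 2 * β + 1) / 2 = (σ + 1) / 2 + β by ring,
    show (σ + 1) / 2 + β + (1 - (ν : ℂ)) / 2 = (σ + 1) / 2 + (1 - (ν : ℂ)) / 2 + β by ring,
    show -(2 * (β + γ)) = -(2 * β) + -(2 * γ) by ring, Complex.cpow_add _ _ two_ne_zero,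
    ← add_assoc, ← add_assoc]
  set A := Complex.Gamma ((σ + 1) / 2 + β)
  set B := Complex.Gamma ((σ + 1) / 2 + (1 - (ν : ℂ)) / 2 + β)
  field_simp

end

/-! ### Weakly singular Volterra operators on `L¹(0, b)` -/

section

variable {b : ℝ} {φ g : ℝ → ℝ}

theorem indicator_mul_indicator_comp_sub {z : ℝ × ℝ} (hz : z ∈ triangle b) (φ g : ℝ → ℝ) :
    ContinuousLinearMap.mul ℝ ℝ ((Ioo 0 b).indicator g z.2)
      ((Ioo 0 b).indicator φ (z.1 - z.2)) = φ (z.1 - z.2) * g z.2 := by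
  have hleft : z.1 - z.2 ∈ Ioo 0 b := ⟨sub_pos.2 hz.2.1, by linarith [hz.1, hz.2.2]⟩
  have hright : z.2 ∈ Ioo 0 b := ⟨hz.1, hz.2.1.trans hz.2.2⟩
  rw [ContinuousLinearMap.mul_apply', indicator_of_mem hright, indicator_of_mem hleft, mul_comm]

theorem integrable_indicator_convolution_integrand (hφ : IntegrableOn φ (Ioo 0 b))
    (hg : IntegrableOn g (Ioo 0 b)) :
    Integrable (fun z : ℝ × ℝ => ContinuousLinearMap.mul ℝ ℝ ((Ioo 0 b).indicator g z.2)
      ((Ioo 0 b).indicator φ (z.1 - z.2))) :=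
  (hg.integrable_indicator measurableSet_Ioo).convolution_integrand _
    (hφ.integrable_indicator measurableSet_Ioo)

theorem integrableOn_triangle_comp_sub_mul (hφ : IntegrableOn φ (Ioo 0 b))
    (hg : IntegrableOn g (Ioo 0 b)) :
    IntegrableOn (fun z : ℝ × ℝ => φ (z.1 - z.2) * g z.2) (triangle b) :=
  (integrable_indicator_convolution_integrand hφ hg).integrableOn.congr_fun
    (fun _ hz => indicator_mul_indicator_comp_sub hz φ g) (measurableSet_triangle b)

theorem setIntegral_triangle_comp_sub_mul_le (hφ : IntegrableOn φ (Ioo 0 b))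
    (hg : IntegrableOn g (Ioo 0 b)) (hφ0 : ∀ x ∈ Ioo 0 b, 0 ≤ φ x) (hg0 : ∀ x ∈ Ioo 0 b, 0 ≤ g x) :
    ∫ z in triangle b, φ (z.1 - z.2) * g z.2 ≤ (∫ x in Ioo 0 b, φ x) * ∫ x in Ioo 0 b, g x := by
  have hint := integrable_indicator_convolution_integrand hφ hg
  calc ∫ z in triangle b, φ (z.1 - z.2) * g z.2
      = ∫ z in triangle b, ContinuousLinearMap.mul ℝ ℝ ((Ioo 0 b).indicator g z.2)
          ((Ioo 0 b).indicator φ (z.1 - z.2)) :=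
        (setIntegral_congr_fun (measurableSet_triangle b)
          fun _ hz => indicator_mul_indicator_comp_sub hz φ g).symm
    _ ≤ ∫ z : ℝ × ℝ, ContinuousLinearMap.mul ℝ ℝ ((Ioo 0 b).indicator g z.2)
          ((Ioo 0 b).indicator φ (z.1 - z.2)) :=
        setIntegral_le_integral hint (Eventually.of_forall fun z =>
          mul_nonneg (indicator_nonneg hg0 _) (indicator_nonneg hφ0 _))
    _ = (∫ x in Ioo 0 b, φ x) * ∫ x in Ioo 0 b, g x := by
        rw [Measure.volume_eq_prod, integral_prod _ hint]
        refine (integral_convolution (ContinuousLinearMap.mul ℝ ℝ)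
          (hg.integrable_indicator measurableSet_Ioo)
          (hφ.integrable_indicator measurableSet_Ioo)).trans ?_
        rw [integral_indicator measurableSet_Ioo, integral_indicator measurableSet_Ioo,
          ContinuousLinearMap.mul_apply', mul_comm]

end

theorem integrableOn_Ioo_rpow_sub_one {e : ℝ} (he : 0 < e) (b : ℝ) :
    IntegrableOn (fun u : ℝ => u ^ (e - 1)) (Ioo 0 b) := by
  rcases le_or_gt b 0 with hb | hb
  · rw [Ioo_eq_empty hb.not_gt]
    exact integrableOn_empty
  · exact (intervalIntegral.integrableOn_Ioo_rpow_iff hb).2 (by linarith)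

theorem integrableOn_triangle_rpow_mul_norm {e b : ℝ} {f : ℝ → ℂ} (he : 0 < e)
    (hf : IntegrableOn f (Ioo 0 b)) :
    IntegrableOn (fun z : ℝ × ℝ => (z.1 - z.2) ^ (e - 1) * ‖f z.2‖) (triangle b) :=
  integrableOn_triangle_comp_sub_mul (integrableOn_Ioo_rpow_sub_one he b) hf.norm

theorem integrableOn_coeFn {b : ℝ} (f : ℝ →₁[volume.restrict (Ioo 0 b)] ℂ) :
    IntegrableOn f (Ioo 0 b) :=
  L1.integrable_coeFn f

/-- The Volterra integral operator with kernel `k`. -/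
noncomputable def volterra (k : ℝ → ℝ → ℂ) (f : ℝ → ℂ) (x : ℝ) : ℂ :=
  ∫ y in Ioo 0 x, k x y * f y

/-- A measurable kernel on the triangle `0 < y < x < b` dominated by `C * (x - y) ^ (e - 1)`, where
`0 < e`. These are the kernels of Volterra operators on `L¹(0, b)` used here. -/
structure IsWeaklySingular (e b C : ℝ) (k : ℝ → ℝ → ℂ) : Prop where
  exp_pos : 0 < e
  const_nonneg : 0 ≤ C
  aestronglyMeasurable :
    AEStronglyMeasurable (fun z : ℝ × ℝ => k z.1 z.2) (volume.restrict (triangle b))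
  norm_le : ∀ x y : ℝ, 0 < y → y < x → x < b → ‖k x y‖ ≤ C * (x - y) ^ (e - 1)

theorem volterra_congr_ae {b x : ℝ} (k : ℝ → ℝ → ℂ) {f g : ℝ → ℂ}
    (h : f =ᵐ[volume.restrict (Ioo 0 b)] g) (hx : x ≤ b) : volterra k f x = volterra k g x :=
  integral_congr_ae (((ae_restrict_of_ae_restrict_of_subset (Ioo_subset_Ioo_right hx) h)).mono
    fun _ hy => congrArg _ hy)

theorem volterra_smul (k : ℝ → ℝ → ℂ) (c : ℂ) (f : ℝ → ℂ) :
    volterra k (c • f) = c • volterra k f := by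
  ext x
  simp only [volterra, Pi.smul_apply, smul_eq_mul, mul_left_comm _ c, integral_const_mul]

namespace IsWeaklySingular

variable {e b C : ℝ} {k : ℝ → ℝ → ℂ} {f : ℝ → ℂ}

theorem norm_mul_le (hk : IsWeaklySingular e b C k) (f : ℝ → ℂ) {x y : ℝ} (hy : 0 < y)
    (hyx : y < x) (hxb : x < b) : ‖k x y * f y‖ ≤ C * ((x - y) ^ (e - 1) * ‖f y‖) := by
  rw [norm_mul, ← mul_assoc]
  gcongr
  exact hk.norm_le x y hy hyx hxb

theorem integrableOn_mul (hk : IsWeaklySingular e b C k) (hf : IntegrableOn f (Ioo 0 b)) :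
    IntegrableOn (fun z : ℝ × ℝ => k z.1 z.2 * f z.2) (triangle b) := by
  have hmeas : AEStronglyMeasurable (fun z : ℝ × ℝ => f z.2) (volume.restrict (triangle b)) := by
    have hindicator := (hf.integrable_indicator measurableSet_Ioo).aestronglyMeasurable
    refine (hindicator.comp_snd (μ := volume)).restrict.congr ?_
    filter_upwards [ae_restrict_mem (measurableSet_triangle b)] with z hz
    exact indicator_of_mem (show z.2 ∈ Ioo 0 b from ⟨hz.1, hz.2.1.trans hz.2.2⟩) f
  refine Integrable.mono' ((integrableOn_triangle_rpow_mul_norm hk.exp_pos hf).const_mul C)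
    (hk.aestronglyMeasurable.mul hmeas) ?_
  filter_upwards [ae_restrict_mem (measurableSet_triangle b)] with z hz
  exact hk.norm_mul_le f hz.1 hz.2.1 hz.2.2

theorem ae_integrableOn (hk : IsWeaklySingular e b C k) (hf : IntegrableOn f (Ioo 0 b)) :
    ∀ᵐ x ∂volume.restrict (Ioo 0 b), IntegrableOn (fun y => k x y * f y) (Ioo 0 x) :=
  ae_integrableOn_of_integrableOn_triangle (hk.integrableOn_mul hf)

theorem integrableOn_volterra (hk : IsWeaklySingular e b C k) (hf : IntegrableOn f (Ioo 0 b)) :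
    IntegrableOn (volterra k f) (Ioo 0 b) :=
  integrableOn_integral_of_integrableOn_triangle (hk.integrableOn_mul hf)

theorem integral_norm_volterra_le (hk : IsWeaklySingular e b C k)
    (hf : IntegrableOn f (Ioo 0 b)) :
    ∫ x in Ioo 0 b, ‖volterra k f x‖ ≤
      C * (∫ u in Ioo 0 b, u ^ (e - 1)) * ∫ x in Ioo 0 b, ‖f x‖ := by
  have hkf := (hk.integrableOn_mul hf).norm
  calc ∫ x in Ioo 0 b, ‖volterra k f x‖
      ≤ ∫ x in Ioo 0 b, ∫ y in Ioo 0 x, ‖k x y * f y‖ :=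
        setIntegral_mono (hk.integrableOn_volterra hf).norm
          (integrableOn_integral_of_integrableOn_triangle hkf)
          fun x => norm_integral_le_integral_norm _
    _ = ∫ z in triangle b, ‖k z.1 z.2 * f z.2‖ := (setIntegral_triangle hkf).symm
    _ ≤ ∫ z in triangle b, C * ((z.1 - z.2) ^ (e - 1) * ‖f z.2‖) :=
        setIntegral_mono_on hkf ((integrableOn_triangle_rpow_mul_norm hk.exp_pos hf).const_mul C)
          (measurableSet_triangle b) fun z hz => hk.norm_mul_le f hz.1 hz.2.1 hz.2.2
    _ ≤ C * (∫ u in Ioo 0 b, u ^ (e - 1)) * ∫ x in Ioo 0 b, ‖f x‖ := by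
        rw [integral_const_mul, mul_assoc]
        gcongr
        · exact hk.const_nonneg
        · exact setIntegral_triangle_comp_sub_mul_le (integrableOn_Ioo_rpow_sub_one hk.exp_pos b)
            hf.norm (fun x hx => Real.rpow_nonneg hx.1.le _) fun x _ => norm_nonneg _

theorem const_mul (hk : IsWeaklySingular e b C k) (c : ℂ) :
    IsWeaklySingular e b (‖c‖ * C) fun x y => c * k x y where
  exp_pos := hk.exp_pos
  const_nonneg := mul_nonneg (norm_nonneg c) hk.const_nonneg
  aestronglyMeasurable := hk.aestronglyMeasurable.const_mul c
  norm_le x y hy hyx hxb := by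
    rw [norm_mul, mul_assoc]
    gcongr
    exact hk.norm_le x y hy hyx hxb

theorem volterra_add (hk : IsWeaklySingular e b C k) {g : ℝ → ℂ} (hf : IntegrableOn f (Ioo 0 b))
    (hg : IntegrableOn g (Ioo 0 b)) :
    volterra k (f + g) =ᵐ[volume.restrict (Ioo 0 b)] volterra k f + volterra k g := by
  filter_upwards [hk.ae_integrableOn hf, hk.ae_integrableOn hg] with x hfx hgx
  simp only [volterra, Pi.add_apply, mul_add]
  exact integral_add hfx hgx

/-- The bounded operator on `L¹(0, b)` with the weakly singular Volterra kernel `k`. -/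
noncomputable def volterraL1 (hk : IsWeaklySingular e b C k) :
    (ℝ →₁[volume.restrict (Ioo 0 b)] ℂ) →L[ℂ] (ℝ →₁[volume.restrict (Ioo 0 b)] ℂ) :=
  LinearMap.mkContinuous
    { toFun f := (hk.integrableOn_volterra (integrableOn_coeFn f)).integrable.toL1
      map_add' f g := by
        rw [← Integrable.toL1_add, Integrable.toL1_eq_toL1_iff]
        refine EventuallyEq.trans ?_
          (hk.volterra_add (integrableOn_coeFn f) (integrableOn_coeFn g))
        filter_upwards [ae_restrict_mem measurableSet_Ioo] with x hx
        exact volterra_congr_ae k (Lp.coeFn_add f g) hx.2.le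
      map_smul' c f := by
        rw [RingHom.id_apply, ← Integrable.toL1_smul', Integrable.toL1_eq_toL1_iff,
          ← volterra_smul]
        filter_upwards [ae_restrict_mem measurableSet_Ioo] with x hx
        exact volterra_congr_ae k (Lp.coeFn_smul c f) hx.2.le }
    (C * ∫ u in Ioo 0 b, u ^ (e - 1)) fun f => by
      rw [LinearMap.coe_mk, AddHom.coe_mk, L1.norm_of_fun_eq_integral_norm,
        L1.norm_eq_integral_norm]
      exact hk.integral_norm_volterra_le (integrableOn_coeFn f)

theorem coeFn_volterraL1 (hk : IsWeaklySingular e b C k)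
    (f : ℝ →₁[volume.restrict (Ioo 0 b)] ℂ) :
    hk.volterraL1 f =ᵐ[volume.restrict (Ioo 0 b)] volterra k f :=
  (hk.integrableOn_volterra (integrableOn_coeFn f)).integrable.coeFn_toL1

theorem volterraL1_toL1 (hk : IsWeaklySingular e b C k) (hf : IntegrableOn f (Ioo 0 b)) :
    hk.volterraL1 (hf.integrable.toL1 f) = (hk.integrableOn_volterra hf).integrable.toL1 := by
  refine Lp.ext ?_
  filter_upwards [hk.coeFn_volterraL1 (hf.integrable.toL1 f),
    (hk.integrableOn_volterra hf).integrable.coeFn_toL1, ae_restrict_mem measurableSet_Ioo]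
    with x hx hx' hxb
  rw [hx, hx', volterra_congr_ae k hf.integrable.coeFn_toL1 hxb.2.le]

theorem norm_volterraL1_le (hk : IsWeaklySingular e b C k) :
    ‖hk.volterraL1‖ ≤ C * ∫ u in Ioo 0 b, u ^ (e - 1) :=
  LinearMap.mkContinuous_norm_le _ (mul_nonneg hk.const_nonneg
    (setIntegral_nonneg measurableSet_Ioo fun _ hu => Real.rpow_nonneg hu.1.le _)) _

theorem volterraL1_const_mul (hk : IsWeaklySingular e b C k) (c : ℂ) :
    (hk.const_mul c).volterraL1 = c • hk.volterraL1 := by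
  ext1 f
  refine Lp.ext ?_
  filter_upwards [(hk.const_mul c).coeFn_volterraL1 f, hk.coeFn_volterraL1 f,
    Lp.coeFn_smul c (hk.volterraL1 f)] with x hcx hx hsmul
  rw [hcx, smul_apply, hsmul, Pi.smul_apply, hx, smul_eq_mul]
  simp only [volterra, mul_assoc, integral_const_mul]

theorem volterraL1_congr {e' C' : ℝ} {l : ℝ → ℝ → ℂ} (hk : IsWeaklySingular e b C k)
    (hl : IsWeaklySingular e' b C' l) (h : k = l) : hk.volterraL1 = hl.volterraL1 := by
  subst h
  rfl

section Series

variable {d : ℕ → ℝ} {κ : ℕ → ℝ → ℝ → ℂ}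

theorem of_hasSum (hκ : ∀ n, IsWeaklySingular e b (d n) (κ n)) (hd : Summable d)
    (h : ∀ x y, 0 < y → y < x → HasSum (fun n => κ n x y) (k x y)) :
    IsWeaklySingular e b (∑' n, d n) k where
  exp_pos := (hκ 0).exp_pos
  const_nonneg := tsum_nonneg fun n => (hκ n).const_nonneg
  aestronglyMeasurable := by
    refine aestronglyMeasurable_of_hasSum (fun n => (hκ n).aestronglyMeasurable) ?_
    filter_upwards [ae_restrict_mem (measurableSet_triangle b)] with z hz
    exact h z.1 z.2 hz.1 hz.2.1
  norm_le x y hy hyx hxb := by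
    rw [← (h x y hy hyx).tsum_eq, ← tsum_mul_right]
    exact tsum_of_norm_bounded (hd.mul_right _).hasSum fun n => (hκ n).norm_le x y hy hyx hxb

theorem hasSum_volterra (hκ : ∀ n, IsWeaklySingular e b (d n) (κ n)) (hd : Summable d)
    (h : ∀ x y, 0 < y → y < x → HasSum (fun n => κ n x y) (k x y))
    (hf : IntegrableOn f (Ioo 0 b)) :
    ∀ᵐ x ∂volume.restrict (Ioo 0 b), HasSum (fun n => volterra (κ n) f x) (volterra k f x) := by
  filter_upwards [ae_all_iff.2 fun n => (hκ n).ae_integrableOn hf,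
    ae_integrableOn_of_integrableOn_triangle (integrableOn_triangle_rpow_mul_norm
      (hκ 0).exp_pos hf), ae_restrict_mem measurableSet_Ioo] with x hκx hmaj hx
  refine hasSum_integral_of_dominated_convergence
    (fun n y => d n * ((x - y) ^ (e - 1) * ‖f y‖)) (fun n => (hκx n).aestronglyMeasurable)
    (fun n => ?_) (Eventually.of_forall fun y => hd.mul_right _) ?_ ?_
  · filter_upwards [ae_restrict_mem measurableSet_Ioo] with y hy
    exact (hκ n).norm_mul_le f hy.1 hy.2 hx.2
  · simp_rw [tsum_mul_right]
    exact hmaj.const_mul _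
  · filter_upwards [ae_restrict_mem measurableSet_Ioo] with y hy
    exact (h x y hy.1 hy.2).mul_right (f y)

theorem hasSum_volterraL1 (hκ : ∀ n, IsWeaklySingular e b (d n) (κ n)) (hd : Summable d)
    (h : ∀ x y, 0 < y → y < x → HasSum (fun n => κ n x y) (k x y))
    (hk : IsWeaklySingular e b C k) :
    HasSum (fun n => (hκ n).volterraL1) hk.volterraL1 := by
  have hnorm : Summable fun n => ‖(hκ n).volterraL1‖ :=
    (hd.mul_right _).of_nonneg_of_le (fun _ => norm_nonneg _) fun n => (hκ n).norm_volterraL1_le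
  suffices ∑' n, (hκ n).volterraL1 = hk.volterraL1 from this ▸ hnorm.of_norm.hasSum
  ext1 f
  have happly : HasSum (fun n => (hκ n).volterraL1 f) ((∑' n, (hκ n).volterraL1) f) :=
    hnorm.of_norm.hasSum.mapL (ContinuousLinearMap.apply ℂ _ f)
  have hnorm_apply : Summable fun n => ‖(hκ n).volterraL1 f‖ :=
    (hnorm.mul_right ‖f‖).of_nonneg_of_le (fun _ => norm_nonneg _)
      fun n => (hκ n).volterraL1.le_opNorm f
  rw [← happly.tsum_eq]
  refine Lp.ext ?_
  filter_upwards [Lp.hasSum_coeFn_tsum (tsum_enorm_ne_top_iff_summable_norm.2 hnorm_apply),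
    ae_all_iff.2 fun n => (hκ n).coeFn_volterraL1 f, hk.coeFn_volterraL1 f,
    hasSum_volterra hκ hd h (integrableOn_coeFn f)] with x hsum hterm hlimit hvolterra
  simp only [hterm] at hsum
  rw [hlimit]
  exact hsum.unique hvolterra

end Series

end IsWeaklySingular

/-! ### The semigroup of Bessel fractional integrals -/

/-- A constant `C` for which `besselFracKernel ν β` is dominated by `C * (x - y) ^ (2 * a - 1)` on
`0 < y < x < b`; its dependence on `β` makes the Neumann series converge in operator norm. -/
noncomputable def besselKernelConst (ν : ℝ) (β : ℂ) (a b : ℝ) : ℝ :=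
  ‖besselCoeff ν β‖ *
    (b ^ (2 * (β.re - a)) * (2 * ∫ t in Ioo (0 : ℝ) 1, t ^ a / resolventWeight ν t))

section

variable {ν a b : ℝ} {α β : ℂ}

theorem besselKernelConst_nonneg (ν : ℝ) (β : ℂ) (a : ℝ) (hb : 0 ≤ b) :
    0 ≤ besselKernelConst ν β a b := by
  have hI : 0 ≤ ∫ t in Ioo (0 : ℝ) 1, t ^ a / resolventWeight ν t :=
    setIntegral_nonneg measurableSet_Ioo fun t ht =>
      div_nonneg (Real.rpow_nonneg ht.1.le _) (resolventWeight_pos ν ht).le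
  unfold besselKernelConst
  positivity

theorem aestronglyMeasurable_besselFracKernel (hν : ν < 1) (hβ : (1 - ν) / 2 < β.re) (b : ℝ) :
    AEStronglyMeasurable (fun z : ℝ × ℝ => besselFracKernel ν β z.2 z.1)
      (volume.restrict (triangle b)) := by
  have hgap : Measurable fun z : ℝ × ℝ => besselGap z.2 z.1 := by
    unfold besselGap
    fun_prop
  have hintegral := (measurable_integral_besselEulerIntegrand ν β).comp measurable_swap
  refine ((hgap.complex_ofReal.inv.const_mul (besselCoeff ν β)).mul
    hintegral).aestronglyMeasurable.congr ?_
  filter_upwards [ae_restrict_mem (measurableSet_triangle b)] with z hz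
  exact (besselFracKernel_eq_integral hν hβ hz.1 (hz.1.trans hz.2.1) hz.2.1.ne).symm

theorem besselFracKernel_isWeaklySingular (hν : ν < 1) (ha : (1 - ν) / 2 < a) (haβ : a ≤ β.re)
    (hb : 0 ≤ b) :
    IsWeaklySingular (2 * a) b (besselKernelConst ν β a b)
      fun x y => besselFracKernel ν β y x where
  exp_pos := by linarith
  const_nonneg := besselKernelConst_nonneg ν β a hb
  aestronglyMeasurable := aestronglyMeasurable_besselFracKernel hν (ha.trans_le haβ) b
  norm_le _ _ hy hyx hxb := norm_besselFracKernel_le_of_lt hν ha haβ hy hyx hxb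

theorem neumannTerm_isWeaklySingular (hν : ν < 1) (hα : (1 - ν) / 2 < α.re) (lam : ℂ)
    (hb : 0 ≤ b) (n : ℕ) :
    IsWeaklySingular (2 * α.re) b
      (‖(lam ^ (n + 1))⁻¹‖ * besselKernelConst ν (α * (n + 1 : ℕ)) α.re b)
      fun x y => neumannTerm ν α lam n y x :=
  (besselFracKernel_isWeaklySingular hν hα
    (re_le_mul_succ_re (re_pos_of_half_lt hν hα).le n) hb).const_mul _

theorem summable_neumannTerm_const (hν : ν < 1) (hα : (1 - ν) / 2 < α.re) (lam : ℂ)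
    (hb : 0 < b) :
    Summable fun n : ℕ =>
      ‖(lam ^ (n + 1))⁻¹‖ * besselKernelConst ν (α * (n + 1 : ℕ)) α.re b := by
  have hr : 0 ≤ b ^ (2 * α.re) / ‖lam‖ := by positivity
  refine ((summable_norm_besselCoeff_mul_pow hν hα hr).mul_right (b ^ (-(2 * α.re)) *
    (2 * ∫ t in Ioo (0 : ℝ) 1, t ^ α.re / resolventWeight ν t))).congr fun n => ?_
  have hexp : b ^ (2 * (α.re * (n + 1 : ℕ) - α.re)) =
      (b ^ (2 * α.re)) ^ (n + 1) * b ^ (-(2 * α.re)) := by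
    rw [← Real.rpow_natCast, ← Real.rpow_mul hb.le, ← Real.rpow_add hb]
    ring_nf
  rw [besselKernelConst, mul_natCast_re, hexp, norm_inv, norm_pow, div_pow]
  ring

theorem besselResolventKernel_isWeaklySingular (hν : ν < 1) (hα : (1 - ν) / 2 < α.re) (lam : ℂ)
    (hb : 0 < b) :
    IsWeaklySingular (2 * α.re) b
      (∑' n : ℕ, ‖(lam ^ (n + 1))⁻¹‖ * besselKernelConst ν (α * (n + 1 : ℕ)) α.re b)
      fun x y => besselResolventKernel ν α lam y x :=
  .of_hasSum (neumannTerm_isWeaklySingular hν hα lam hb.le)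
    (summable_neumannTerm_const hν hα lam hb)
    fun _ _ hy hyx => hasSum_neumannTerm hν hα lam hy (hy.trans hyx) hyx.ne

end

theorem exists_complex_polynomial_near_of_continuousOn (a b : ℝ) {g : ℝ → ℂ}
    (hg : ContinuousOn g (Icc a b)) {ε : ℝ} (hε : 0 < ε) :
    ∃ P : Polynomial ℂ, ∀ x ∈ Icc a b, ‖P.eval (x : ℂ) - g x‖ < ε := by
  obtain ⟨P, hP⟩ := exists_polynomial_near_of_continuousOn a b (fun x => (g x).re)
    (Complex.continuous_re.comp_continuousOn hg) (ε / 2) (half_pos hε)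
  obtain ⟨Q, hQ⟩ := exists_polynomial_near_of_continuousOn a b (fun x => (g x).im)
    (Complex.continuous_im.comp_continuousOn hg) (ε / 2) (half_pos hε)
  refine ⟨P.map Complex.ofRealHom + .C Complex.I * Q.map Complex.ofRealHom, fun x hx => ?_⟩
  have heval : (P.map Complex.ofRealHom + .C Complex.I * Q.map Complex.ofRealHom).eval (x : ℂ) =
      ((P.eval x : ℝ) : ℂ) + Complex.I * ((Q.eval x : ℝ) : ℂ) := by
    simp [← Complex.ofRealHom_eq_coe, Polynomial.eval_map_apply]
  rw [heval]
  refine (Complex.norm_le_abs_re_add_abs_im _).trans_lt ?_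
  simpa using add_lt_add (hP x hx) (hQ x hx)

theorem integrableOn_Ioo_polynomial (b : ℝ) (P : Polynomial ℂ) :
    IntegrableOn (fun y : ℝ => P.eval (y : ℂ)) (Ioo 0 b) :=
  (show Continuous fun y : ℝ => P.eval (y : ℂ) by fun_prop).integrableOn_Icc.mono_set
    Ioo_subset_Icc_self

/-- Polynomials as elements of `L¹(0, b)`. -/
noncomputable def polynomialL1 (b : ℝ) :
    Polynomial ℂ →ₗ[ℂ] (ℝ →₁[volume.restrict (Ioo 0 b)] ℂ) where
  toFun P := (integrableOn_Ioo_polynomial b P).integrable.toL1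
  map_add' P Q := by
    simp only [Polynomial.eval_add]
    exact Integrable.toL1_add _ _ _ _
  map_smul' c P := by
    simp only [Polynomial.eval_smul]
    exact Integrable.toL1_smul' _ _ c

theorem exists_polynomial_integral_norm_sub_le {b : ℝ} (hb : 0 < b) {f : ℝ → ℂ}
    (hf : IntegrableOn f (Ioo 0 b)) {ε : ℝ} (hε : 0 < ε) :
    ∃ P : Polynomial ℂ, ∫ x in Ioo 0 b, ‖f x - P.eval (x : ℂ)‖ ≤ ε := by
  obtain ⟨g, hfg, hg⟩ := hf.integrable.exists_boundedContinuous_integral_sub_le (half_pos hε)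
  obtain ⟨P, hP⟩ := exists_complex_polynomial_near_of_continuousOn 0 b g.continuous.continuousOn
    (ε := ε / (2 * b)) (by positivity)
  have hPint : IntegrableOn (fun y : ℝ => P.eval (y : ℂ)) (Ioo 0 b) :=
    integrableOn_Ioo_polynomial b P
  have hconst : IntegrableOn (fun _ => ε / (2 * b)) (Ioo 0 b) := integrableOn_const (by simp)
  have hfg_norm : IntegrableOn (fun x => ‖f x - g x‖) (Ioo 0 b) := (hf.integrable.sub hg).norm
  refine ⟨P, ?_⟩
  calc ∫ x in Ioo 0 b, ‖f x - P.eval (x : ℂ)‖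
      ≤ ∫ x in Ioo 0 b, (‖f x - g x‖ + ε / (2 * b)) := by
        refine setIntegral_mono_on (hf.sub hPint).norm (hfg_norm.add hconst)
          measurableSet_Ioo fun x hx => (norm_sub_le_norm_sub_add_norm_sub _ (g x) _).trans ?_
        rw [norm_sub_rev (g x)]
        gcongr
        exact (hP x (Ioo_subset_Icc_self hx)).le
    _ = (∫ x in Ioo 0 b, ‖f x - g x‖) + ε / 2 := by
        rw [integral_add hfg_norm hconst, setIntegral_const, smul_eq_mul, measureReal_def,
          Real.volume_Ioo, ENNReal.toReal_ofReal (by linarith)]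
        field_simp
        ring
    _ ≤ ε := by linarith

theorem denseRange_polynomialL1 {b : ℝ} (hb : 0 < b) : DenseRange (polynomialL1 b) := by
  refine Metric.denseRange_iff.2 fun f ε hε => ?_
  have hf := integrableOn_coeFn f
  obtain ⟨P, hP⟩ := exists_polynomial_integral_norm_sub_le hb hf (half_pos hε)
  refine ⟨P, lt_of_eq_of_lt ?_ (hP.trans_lt (half_lt_self hε))⟩
  rw [dist_eq_norm, L1.norm_eq_integral_norm]
  refine integral_congr_ae ?_
  filter_upwards [Lp.coeFn_sub f (polynomialL1 b P),
    (integrableOn_Ioo_polynomial b P).integrable.coeFn_toL1] with x hsub hx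
  rw [hsub, Pi.sub_apply, ← hx]
  rfl

theorem continuousLinearMap_ext_pow {b : ℝ} (hb : 0 < b)
    {T U : (ℝ →₁[volume.restrict (Ioo 0 b)] ℂ) →L[ℂ] (ℝ →₁[volume.restrict (Ioo 0 b)] ℂ)}
    (h : ∀ n : ℕ, T (polynomialL1 b (.X ^ n)) = U (polynomialL1 b (.X ^ n))) : T = U := by
  have hcomp : T.toLinearMap ∘ₗ polynomialL1 b = U.toLinearMap ∘ₗ polynomialL1 b :=
    Polynomial.lhom_ext' fun n => LinearMap.ext_ring <| by
      simpa only [LinearMap.comp_apply, Polynomial.monomial_one_right_eq_X_pow,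
        ContinuousLinearMap.coe_coe] using h n
  exact DFunLike.coe_injective ((denseRange_polynomialL1 hb).equalizer T.continuous U.continuous
    (congrArg DFunLike.coe hcomp))

section

variable {ν b : ℝ} {α β γ : ℂ}

theorem volterra_besselFracKernel_pow (hν : ν < 1) (hβ : 0 < β.re) (n : ℕ) {x : ℝ} (hx : 0 < x) :
    volterra (fun x y => besselFracKernel ν β y x) (fun y => (y : ℂ) ^ n) x =
      besselMoment ν β n * (x : ℂ) ^ (n + 2 * β) := by
  simp only [volterra, ← Complex.cpow_natCast]
  exact integral_besselFracKernel_mul_cpow hν hβ (by simp) hx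

theorem volterra_volterra_besselFracKernel_pow (hν : ν < 1) (hβ : 0 < β.re) (hγ : 0 < γ.re)
    (n : ℕ) {x : ℝ} (hx : 0 < x) :
    volterra (fun x y => besselFracKernel ν γ y x)
      (volterra (fun x y => besselFracKernel ν β y x) fun y => (y : ℂ) ^ n) x =
      volterra (fun x y => besselFracKernel ν (β + γ) y x) (fun y => (y : ℂ) ^ n) x := by
  have hσ : 0 ≤ ((n : ℂ) + 2 * β).re := by
    simpa using add_nonneg n.cast_nonneg (by positivity)
  have hinner : ∀ y ∈ Ioo 0 x, besselFracKernel ν γ y x *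
      volterra (fun x y => besselFracKernel ν β y x) (fun y => (y : ℂ) ^ n) y =
        besselMoment ν β n * (besselFracKernel ν γ y x * (y : ℂ) ^ (n + 2 * β)) := fun y hy => by
    rw [volterra_besselFracKernel_pow hν hβ n hy.1, mul_left_comm]
  rw [volterra, setIntegral_congr_fun measurableSet_Ioo hinner, integral_const_mul,
    integral_besselFracKernel_mul_cpow hν hγ hσ hx,
    volterra_besselFracKernel_pow hν (add_pos hβ hγ) n hx, ← mul_assoc,
    besselMoment_mul hν hβ (by simp), add_assoc, ← mul_add]

theorem volterraL1_besselFracKernel_mul (hν : ν < 1) (hβ : 0 < β.re) (hγ : 0 < γ.re) (hb : 0 < b)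
    {e₁ e₂ e₃ C₁ C₂ C₃ : ℝ}
    (hkβ : IsWeaklySingular e₁ b C₁ fun x y => besselFracKernel ν β y x)
    (hkγ : IsWeaklySingular e₂ b C₂ fun x y => besselFracKernel ν γ y x)
    (hkβγ : IsWeaklySingular e₃ b C₃ fun x y => besselFracKernel ν (β + γ) y x) :
    hkγ.volterraL1 * hkβ.volterraL1 = hkβγ.volterraL1 := by
  refine continuousLinearMap_ext_pow hb fun n => ?_
  have hpow := integrableOn_Ioo_polynomial b (.X ^ n)
  change hkγ.volterraL1 (hkβ.volterraL1 (hpow.integrable.toL1)) =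
    hkβγ.volterraL1 hpow.integrable.toL1
  rw [hkβ.volterraL1_toL1 hpow, hkγ.volterraL1_toL1 (hkβ.integrableOn_volterra hpow),
    hkβγ.volterraL1_toL1 hpow, Integrable.toL1_eq_toL1_iff]
  filter_upwards [ae_restrict_mem measurableSet_Ioo] with x hx
  simpa only [Polynomial.eval_pow, Polynomial.eval_X] using
    volterra_volterra_besselFracKernel_pow hν hβ hγ n hx.1

theorem volterraL1_besselFracKernel_mul_succ (hν : ν < 1) (hα : (1 - ν) / 2 < α.re) (hb : 0 < b)
    {e C : ℝ} (hG : IsWeaklySingular e b C fun x y => besselFracKernel ν α y x) (n : ℕ) :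
    (besselFracKernel_isWeaklySingular hν hα (re_le_mul_succ_re (re_pos_of_half_lt hν hα).le n)
      hb.le).volterraL1 = hG.volterraL1 ^ (n + 1) := by
  have hα₀ := re_pos_of_half_lt hν hα
  induction n with
  | zero =>
    exact (IsWeaklySingular.volterraL1_congr _ hG (by simp)).trans (pow_one hG.volterraL1).symm
  | succ n ih =>
    have hre := re_le_mul_succ_re hα₀.le n
    have hsum : IsWeaklySingular (2 * α.re) b (besselKernelConst ν (α * (n + 1 : ℕ) + α) α.re b)
        fun x y => besselFracKernel ν (α * (n + 1 : ℕ) + α) y x :=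
      besselFracKernel_isWeaklySingular hν hα (by rw [Complex.add_re]; linarith) hb.le
    rw [pow_succ', ← ih,
      volterraL1_besselFracKernel_mul hν (hα₀.trans_le hre) hα₀ hb _ hG hsum]
    refine IsWeaklySingular.volterraL1_congr _ _ ?_
    push_cast
    simp only [mul_add, mul_one]

end

/-! ### Resolvents -/

section

variable {𝕜 A : Type*} [Field 𝕜] [Ring A] [Algebra 𝕜 A] [TopologicalSpace A]
  [IsTopologicalRing A] [T2Space A] {c : 𝕜} {T K : A}

theorem commute_of_hasSum_pow (h : HasSum (fun n => (c ^ (n + 1))⁻¹ • T ^ (n + 1)) K) :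
    Commute T K :=
  (h.mul_left T).unique <| (h.mul_right T).congr_fun fun n => by
    rw [mul_smul_comm, smul_mul_assoc, ← pow_succ, ← pow_succ']

theorem mul_eq_smul_sub_of_hasSum_pow [ContinuousConstSMul 𝕜 A] (hc : c ≠ 0)
    (h : HasSum (fun n => (c ^ (n + 1))⁻¹ • T ^ (n + 1)) K) : T * K = c • K - T := by
  have htail : HasSum (fun n => T * ((c ^ (n + 1))⁻¹ • T ^ (n + 1))) (c • K - T) := by
    have hshift := (hasSum_nat_add_iff' 1).2 (h.const_smul c)
    simp only [Finset.sum_range_one, zero_add, pow_one, smul_inv_smul₀ hc] at hshift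
    refine hshift.congr_fun fun n => ?_
    rw [mul_smul_comm, ← pow_succ', smul_smul, pow_succ c (n + 1), mul_inv_rev,
      mul_inv_cancel_left₀ hc]
  exact (h.mul_left T).unique htail

end

section

variable {ν b : ℝ} {α : ℂ}

theorem hasSum_volterraL1_besselResolventKernel (hν : ν < 1) (hα : (1 - ν) / 2 < α.re) (lam : ℂ)
    (hb : 0 < b) {e C D : ℝ}
    (hG : IsWeaklySingular e b C fun x y => besselFracKernel ν α y x)
    (hK : IsWeaklySingular (2 * α.re) b D fun x y => besselResolventKernel ν α lam y x) :
    HasSum (fun n => (lam ^ (n + 1))⁻¹ • hG.volterraL1 ^ (n + 1)) hK.volterraL1 := by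
  refine (IsWeaklySingular.hasSum_volterraL1 (neumannTerm_isWeaklySingular hν hα lam hb.le)
    (summable_neumannTerm_const hν hα lam hb)
    (fun _ _ hy hyx => hasSum_neumannTerm hν hα lam hy (hy.trans hyx) hyx.ne) hK).congr_fun
    fun n => ?_
  rw [← volterraL1_besselFracKernel_mul_succ hν hα hb hG]
  exact (IsWeaklySingular.volterraL1_const_mul _ _).symm

end

namespace IsWeaklySingular

variable {b : ℝ} {e₁ e₂ e₃ e₄ C₁ C₂ C₃ C₄ : ℝ} {k₁ k₂ k₃ k₄ : ℝ → ℝ → ℂ} {c : ℂ} {f : ℝ → ℂ}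

theorem volterra_volterra_ae_eq (h₁ : IsWeaklySingular e₁ b C₁ k₁)
    (h₂ : IsWeaklySingular e₂ b C₂ k₂) (h₃ : IsWeaklySingular e₃ b C₃ k₃)
    (h₄ : IsWeaklySingular e₄ b C₄ k₄)
    (h : h₁.volterraL1 * h₂.volterraL1 = c • h₃.volterraL1 - h₄.volterraL1)
    (hf : IntegrableOn f (Ioo 0 b)) :
    volterra k₁ (volterra k₂ f) =ᵐ[volume.restrict (Ioo 0 b)]
      c • volterra k₃ f - volterra k₄ f := by
  have happly := DFunLike.congr_fun h (hf.integrable.toL1 f)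
  rw [sub_apply, smul_apply, ContinuousLinearMap.mul_def,
    ContinuousLinearMap.comp_apply, h₂.volterraL1_toL1 hf,
    h₁.volterraL1_toL1 (h₂.integrableOn_volterra hf), h₃.volterraL1_toL1 hf, h₄.volterraL1_toL1 hf,
    ← Integrable.toL1_smul', ← Integrable.toL1_sub, Integrable.toL1_eq_toL1_iff] at happly
  exact happly

end IsWeaklySingular

theorem ae_Ioi_of_forall_ae_Ioo {P : ℝ → Prop}
    (h : ∀ b : ℝ, 0 < b → ∀ᵐ x ∂volume.restrict (Ioo 0 b), P x) :
    ∀ᵐ x ∂volume.restrict (Ioi (0 : ℝ)), P x := by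
  have hunion : Ioi (0 : ℝ) = ⋃ n : ℕ, Ioo (0 : ℝ) (n + 1) := by
    ext x
    simp only [mem_Ioi, mem_iUnion, mem_Ioo]
    refine ⟨fun hx => ?_, fun ⟨_, hx, _⟩ => hx⟩
    obtain ⟨n, hn⟩ := exists_nat_gt x
    exact ⟨n, hx, by linarith⟩
  rw [hunion, ae_restrict_iUnion_iff]
  exact fun n => h _ (by positivity)

theorem mem_locIntegrableSpace_zero {f : ℝ → ℂ} :
    f ∈ locIntegrableSpace 0 ↔ ∀ b : ℝ, 0 < b → IntegrableOn f (Ioo 0 b) := by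
  simp [locIntegrableSpace]

theorem resolventForm_eq (lam : ℂ) (k : ℝ → ℝ → ℂ) (f : ℝ → ℂ) :
    resolventForm lam k f = (-(1 / lam)) • f + (-(1 / lam)) • volterra k f := by
  ext x
  simp only [resolventForm, Pi.add_apply, Pi.smul_apply, smul_eq_mul, volterra]
  ring

section

variable {e : ℝ} {C D : ℝ → ℝ} {g k : ℝ → ℝ → ℂ} {f : ℝ → ℂ} {lam : ℂ}

theorem convergesAE_of_isWeaklySingular (hg : ∀ b, 0 < b → IsWeaklySingular e b (C b) g)
    (hf : f ∈ locIntegrableSpace 0) : ConvergesAE g f :=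
  ae_Ioi_of_forall_ae_Ioo fun b hb =>
    (hg b hb).ae_integrableOn (mem_locIntegrableSpace_zero.1 hf b hb)

theorem volterra_mem_locIntegrableSpace (hg : ∀ b, 0 < b → IsWeaklySingular e b (C b) g)
    (hf : f ∈ locIntegrableSpace 0) : volterra g f ∈ locIntegrableSpace 0 :=
  mem_locIntegrableSpace_zero.2 fun b hb =>
    (hg b hb).integrableOn_volterra (mem_locIntegrableSpace_zero.1 hf b hb)

theorem resolventForm_mem_locIntegrableSpace (hk : ∀ b, 0 < b → IsWeaklySingular e b (D b) k)
    (lam : ℂ) (hf : f ∈ locIntegrableSpace 0) : resolventForm lam k f ∈ locIntegrableSpace 0 := by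
  have hkf := volterra_mem_locIntegrableSpace hk hf
  rw [mem_locIntegrableSpace_zero] at hf hkf ⊢
  rw [resolventForm_eq]
  exact fun b hb => ((hf b hb).smul _).add ((hkf b hb).smul _)

theorem isResolventAt_volterra (hlam : lam ≠ 0)
    (hg : ∀ b, 0 < b → IsWeaklySingular e b (C b) g)
    (hk : ∀ b, 0 < b → IsWeaklySingular e b (D b) k)
    (h : ∀ b (hb : 0 < b), HasSum (fun n => (lam ^ (n + 1))⁻¹ • (hg b hb).volterraL1 ^ (n + 1))
      (hk b hb).volterraL1) :
    IsResolventAt (locIntegrableSpace 0) (volterra g) lam (resolventForm lam k) := by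
  refine ⟨fun f => volterra_mem_locIntegrableSpace hg,
    fun f => resolventForm_mem_locIntegrableSpace hk lam, fun f hf => ?_, fun f hf => ?_⟩ <;>
    refine ae_Ioi_of_forall_ae_Ioo fun b hb => ?_ <;>
    replace hf := mem_locIntegrableSpace_zero.1 hf b hb <;>
    have hmul := mul_eq_smul_sub_of_hasSum_pow hlam (h b hb)
  · have hkf := (hk b hb).integrableOn_volterra hf
    rw [resolventForm_eq]
    filter_upwards [(hg b hb).volterra_add (hf.smul (-(1 / lam))) (hkf.smul (-(1 / lam))),
      (hg b hb).volterra_volterra_ae_eq (hk b hb) (hk b hb) (hg b hb) hmul hf] with x hadd hgk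
    rw [hadd, volterra_smul, volterra_smul]
    simp only [Pi.add_apply, Pi.smul_apply, Pi.sub_apply, smul_eq_mul] at hgk ⊢
    rw [hgk]
    field_simp
    ring
  · rw [commute_of_hasSum_pow (h b hb)] at hmul
    have hgf := (hg b hb).integrableOn_volterra hf
    have hsub : (fun x => volterra g f x - lam * f x) = volterra g f + (-lam) • f := by
      rw [neg_smul, ← sub_eq_add_neg]
      rfl
    rw [resolventForm_eq, hsub]
    filter_upwards [(hk b hb).volterra_add hgf (hf.smul (-lam)),
      (hk b hb).volterra_volterra_ae_eq (hg b hb) (hk b hb) (hg b hb) hmul hf] with x hadd hkg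
    rw [volterra_smul] at hadd
    simp only [Pi.add_apply, Pi.smul_apply, Pi.sub_apply, smul_eq_mul] at hadd hkg ⊢
    rw [hadd, hkg]
    field_simp
    ring

end

/-! ### Conjugation by powers -/

theorem mem_locIntegrableSpace_iff {ν : ℝ} {f : ℝ → ℂ} :
    f ∈ locIntegrableSpace ν ↔ (fun y => ((y ^ ν : ℝ) : ℂ) * f y) ∈ locIntegrableSpace 0 :=
  mem_locIntegrableSpace_zero.symm

theorem ofReal_rpow_ne_zero {x : ℝ} (hx : 0 < x) (ν : ℝ) : ((x ^ ν : ℝ) : ℂ) ≠ 0 :=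
  Complex.ofReal_ne_zero.2 (Real.rpow_pos_of_pos hx ν).ne'

/-- On `0 < y < x` the kernel `g' x y` is `x ^ (-ν) * g x y * y ^ ν`, so that multiplication by
`x ^ ν` intertwines the Volterra operators with kernels `g'` and `g`. -/
def IsConjByRpow (ν : ℝ) (g' g : ℝ → ℝ → ℂ) : Prop :=
  ∀ x y, 0 < y → y < x → g' x y * ((x ^ ν : ℝ) : ℂ) = g x y * ((y ^ ν : ℝ) : ℂ)

section

variable {ν : ℝ} {g g' k k' : ℝ → ℝ → ℂ} {lam : ℂ}

theorem convergesAE_of_conj (hgg : IsConjByRpow ν g' g) {f : ℝ → ℂ}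
    (h : ConvergesAE g fun y => ((y ^ ν : ℝ) : ℂ) * f y) : ConvergesAE g' f := by
  filter_upwards [h, ae_restrict_mem measurableSet_Ioi] with x hx hx0
  refine IntegrableOn.congr_fun (hx.const_mul ((x ^ ν : ℝ) : ℂ)⁻¹) (fun y hy => ?_)
    measurableSet_Ioo
  rw [inv_mul_eq_iff_eq_mul₀ (ofReal_rpow_ne_zero hx0 ν)]
  linear_combination (-f y) * hgg x y hy.1 hy.2

theorem volterra_conj (hgg : IsConjByRpow ν g' g) (f : ℝ → ℂ) (x : ℝ) :
    ((x ^ ν : ℝ) : ℂ) * volterra g' f x = volterra g (fun y => ((y ^ ν : ℝ) : ℂ) * f y) x := by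
  rw [volterra, volterra, ← integral_const_mul]
  refine setIntegral_congr_fun measurableSet_Ioo fun y hy => ?_
  linear_combination f y * hgg x y hy.1 hy.2

theorem resolventForm_conj (hkk : IsConjByRpow ν k' k) (f : ℝ → ℂ) (x : ℝ) :
    ((x ^ ν : ℝ) : ℂ) * resolventForm lam k' f x =
      resolventForm lam k (fun y => ((y ^ ν : ℝ) : ℂ) * f y) x := by
  simp only [resolventForm_eq, Pi.add_apply, Pi.smul_apply, smul_eq_mul, ← volterra_conj hkk]
  ring

theorem isResolventAt_of_conj (hgg : IsConjByRpow ν g' g) (hkk : IsConjByRpow ν k' k)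
    (h : IsResolventAt (locIntegrableSpace 0) (volterra g) lam (resolventForm lam k)) :
    IsResolventAt (locIntegrableSpace ν) (volterra g') lam (resolventForm lam k') := by
  obtain ⟨hmem, hmem_resolvent, hright, hleft⟩ := h
  refine ⟨fun f hf => ?_, fun f hf => ?_, fun f hf => ?_, fun f hf => ?_⟩ <;>
    rw [mem_locIntegrableSpace_iff] at hf
  · rw [mem_locIntegrableSpace_iff]
    simp only [volterra_conj hgg]
    exact hmem _ hf
  · rw [mem_locIntegrableSpace_iff]
    simp only [resolventForm_conj hkk]
    exact hmem_resolvent _ hf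
  · filter_upwards [hright _ hf, ae_restrict_mem measurableSet_Ioi] with x hx hx0
    refine mul_left_cancel₀ (ofReal_rpow_ne_zero hx0 ν) ?_
    simp only [mul_sub, mul_left_comm _ lam, volterra_conj hgg, resolventForm_conj hkk]
    exact hx
  · filter_upwards [hleft _ hf, ae_restrict_mem measurableSet_Ioi] with x hx hx0
    refine mul_left_cancel₀ (ofReal_rpow_ne_zero hx0 ν) ?_
    simp only [resolventForm_conj hkk, mul_sub, mul_left_comm _ lam, volterra_conj hgg]
    exact hx

end

section

variable {ν : ℝ} {α : ℂ}

theorem isConjByRpow_besselFracKernel (ν : ℝ) (hα : 0 < α.re) :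
    IsConjByRpow ν (fun x y => besselFracKernel ν α x y) fun x y => besselFracKernel ν α y x :=
  fun _ _ hy hyx => besselFracKernel_symm ν hα (hy.trans hyx) hy hyx.ne'

theorem isConjByRpow_besselResolventKernel (hν : ν < 1) (hα : (1 - ν) / 2 < α.re) (lam : ℂ) :
    IsConjByRpow ν (fun x y => besselResolventKernel ν α lam x y)
      fun x y => besselResolventKernel ν α lam y x :=
  fun _ _ hy hyx => besselResolventKernel_symm hν hα lam (hy.trans hyx) hy hyx.ne'

theorem IsConjByRpow.eq_of_zero {g g' : ℝ → ℝ → ℂ} (h : IsConjByRpow 0 g' g) {x y : ℝ}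
    (hy : 0 < y) (hyx : y < x) : g' x y = g x y := by
  simpa only [Real.rpow_zero, Complex.ofReal_one, mul_one] using h x y hy hyx

end

theorem theorem9_general (ν : ℝ) (hν1 : ν < 1) (α : ℂ) (hα : (1 - ν) / 2 < α.re)
    (lam : ℂ) (hlam : lam ≠ 0) :
    (∀ z : ℂ, Summable fun k : ℕ => besselWrightTerm α ν z (k + 1)) ∧
    (∀ p q : ℝ, 0 < p → 0 < q → p ≠ q →
      IntegrableOn (besselResolventIntegrand ν α lam p q) (Ioo 0 1)) ∧
    (∀ f ∈ locIntegrableSpace 0,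
      ConvergesAE (fun x y => besselFracKernel ν α y x) f ∧
      ConvergesAE (fun x y => besselResolventKernel ν α lam y x) f) ∧
    IsResolventAt (locIntegrableSpace 0) (besselFracIntLeft ν α 0) lam
      (resolventForm lam fun x y => besselResolventKernel ν α lam y x) ∧
    (∀ f ∈ locIntegrableSpace ν,
      ConvergesAE (fun x y => besselFracKernel ν α x y) f ∧
      ConvergesAE (fun x y => besselResolventKernel ν α lam x y) f) ∧
    IsResolventAt (locIntegrableSpace ν) (besselFracIntLeft' ν α 0) lam
      (resolventForm lam fun x y => besselResolventKernel ν α lam x y) ∧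
    (ν = 0 → ∀ x y : ℝ, 0 < y → y < x →
      besselFracKernel ν α y x = ((x - y : ℝ) : ℂ) ^ (2 * α - 1) / Complex.Gamma (2 * α) ∧
      besselFracKernel ν α x y = ((x - y : ℝ) : ℂ) ^ (2 * α - 1) / Complex.Gamma (2 * α) ∧
      besselResolventKernel ν α lam y x = (1 / lam) * ((x - y : ℝ) : ℂ) ^ (2 * α - 1) *
        mittagLeffler (2 * α) (2 * α) (((x - y : ℝ) : ℂ) ^ (2 * α) / lam) ∧
      besselResolventKernel ν α lam x y = (1 / lam) * ((x - y : ℝ) : ℂ) ^ (2 * α - 1) *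
        mittagLeffler (2 * α) (2 * α) (((x - y : ℝ) : ℂ) ^ (2 * α) / lam)) := by
  have hα₀ := re_pos_of_half_lt hν1 hα
  have hG := fun b (hb : 0 < b) => besselFracKernel_isWeaklySingular hν1 hα le_rfl hb.le
  have hK := fun b (hb : 0 < b) => besselResolventKernel_isWeaklySingular hν1 hα lam hb
  have hGconj := isConjByRpow_besselFracKernel ν hα₀
  have hKconj := isConjByRpow_besselResolventKernel hν1 hα lam
  have hres := isResolventAt_volterra hlam hG hK fun b hb =>
    hasSum_volterraL1_besselResolventKernel hν1 hα lam hb (hG b hb) (hK b hb)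
  refine ⟨besselWrightTerm_summable hν1 hα,
    fun p q => integrableOn_besselResolventIntegrand hν1 hα lam, fun f hf =>
      ⟨convergesAE_of_isWeaklySingular hG hf, convergesAE_of_isWeaklySingular hK hf⟩, hres,
    fun f hf => ?_, isResolventAt_of_conj hGconj hKconj hres, ?_⟩
  · rw [mem_locIntegrableSpace_iff] at hf
    exact ⟨convergesAE_of_conj hGconj (convergesAE_of_isWeaklySingular hG hf),
      convergesAE_of_conj hKconj (convergesAE_of_isWeaklySingular hK hf)⟩
  · rintro rfl x y hy hyx
    have hG₀ := besselFracKernel_zero hα₀ hy hyx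
    have hK₀ := besselResolventKernel_zero (α := α) (by linarith) lam hy hyx
    exact ⟨hG₀, (hGconj.eq_of_zero hy hyx).trans hG₀, hK₀, (hKconj.eq_of_zero hy hyx).trans hK₀⟩

theorem theorem9 (ν : ℝ) (hν0 : 0 ≤ ν) (hν1 : ν < 1) (α : ℂ) (hα : (1 - ν) / 2 < α.re)
    (lam : ℂ) (hlam : lam ≠ 0) :
    -- the series and the integral that define the kernel converge
    (∀ z : ℂ, Summable fun k : ℕ => besselWrightTerm α ν z (k + 1)) ∧
    (∀ p q : ℝ, 0 < p → 0 < q → p ≠ q →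
      IntegrableOn (besselResolventIntegrand ν α lam p q) (Ioo 0 1)) ∧
    -- the resolvent of the operator with the kernel `G(y, x)`
    (∀ f ∈ locIntegrableSpace 0,
      ConvergesAE (fun x y => besselFracKernel ν α y x) f ∧
      ConvergesAE (fun x y => besselResolventKernel ν α lam y x) f) ∧
    IsResolventAt (locIntegrableSpace 0) (besselFracIntLeft ν α 0) lam
      (resolventForm lam fun x y => besselResolventKernel ν α lam y x) ∧
    -- the resolvent of the operator with the kernel `G(x, y)`
    (∀ f ∈ locIntegrableSpace ν,
      ConvergesAE (fun x y => besselFracKernel ν α x y) f ∧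
      ConvergesAE (fun x y => besselResolventKernel ν α lam x y) f) ∧
    IsResolventAt (locIntegrableSpace ν) (besselFracIntLeft' ν α 0) lam
      (resolventForm lam fun x y => besselResolventKernel ν α lam x y) ∧
    -- for `ν = 0` this is the formula for Riemann-Liouville integrals of order `2α`
    (ν = 0 → ∀ x y : ℝ, 0 < y → y < x →
      besselFracKernel ν α y x = ((x - y : ℝ) : ℂ) ^ (2 * α - 1) / Complex.Gamma (2 * α) ∧
      besselFracKernel ν α x y = ((x - y : ℝ) : ℂ) ^ (2 * α - 1) / Complex.Gamma (2 * α) ∧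
      besselResolventKernel ν α lam y x = (1 / lam) * ((x - y : ℝ) : ℂ) ^ (2 * α - 1) *
        mittagLeffler (2 * α) (2 * α) (((x - y : ℝ) : ℂ) ^ (2 * α) / lam) ∧
      besselResolventKernel ν α lam x y = (1 / lam) * ((x - y : ℝ) : ℂ) ^ (2 * α - 1) *
        mittagLeffler (2 * α) (2 * α) (((x - y : ℝ) : ℂ) ^ (2 * α) / lam)) :=
  theorem9_general ν hν1 α hα lam hlam
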